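/- Let $d\ge 1$ and let $\Omega\subset\mathbb R^d$ be a bounded, open, connected set with $C^1$ boundary $\Gamma=\partial\Omega$ and outward unit normal $\nu$. Let $\Gamma_D,\Gamma_N\subset\Gamma$ be disjoint and relatively open in $\Gamma$, with $\Gamma=\overline{\Gamma}_D\cup\overline{\Gamma}_N$ and $\overline{\Gamma}_D\cap\overline{\Gamma}_N$ of zero $(d-1)$-dimensional surface measure. Let $\alpha,\beta>1$, $C>0$, $z_0\in\mathbb R$, $\gamma=\alpha\beta$ and $\beta'=\beta/(\beta-1)$. Let $j\in L^{\beta'}(\Gamma_N)$ with $j\ge 0$, and let $\psi\in C(\overline\Omega)\cap W^{1,\gamma}(\Omega)$. Then there is a constant $C_0>0$, depending only on $\Omega,\Gamma_D,\Gamma_N,\alpha,\beta,C,z_0,j,\psi$, with the following property. Let $g\in C^1([0,\infty))$ be non-negative and non-decreasing with $$\frac{z^{1/(\alpha-1)}}{C}\le g(z)\le C\bigl(z^{1/(\alpha-1)}+1\bigr)\qquad\text{for all } z\ge 0 \text{ with } z\ge z_0 .$$ Let $H\in C^2(\overline\Omega\times\mathbb R^d)$ be bounded from below, with $p\mapsto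 H(x,p)$ strictly convex for every $x\in\Omega$, such that for all $(x,p)\in\Omega\times\mathbb R^d$ $$\frac{|p|^\beta}{C}-C\le H(x,p)\le C(|p|^\beta+1),\qquad |D_xH(x,p)|\le C(|p|^\beta+1),\qquad |D_pH(x,p)|\le C(|p|^{\beta-1}+1),$$ $$-H(x,p)+D_pH(x,p)\cdot p\ \ge\ \frac{|p|^\beta}{C}-C .$$ Let $(m,u)$ be a classical solution of the mean-field game, that is, $m\in C^1(\Omega)\cap C(\overline\Omega)$, $m\ge0$, $u\in C^2(\Omega)\cap C^1(\overline\Omega)$, $$H(x,Du)=g(m)\quad\text{and}\quad -\operatorname{div}\bigl(m\,D_pH(x,Du)\bigr)=0\qquad\text{in }\Omega,$$ and, almost everywhere with respect to surface measure, $$m\,D_pH(x,Du)\cdot\nu=j\ \text{ on }\Gamma_N,\qquad m\,D_pH(x,Du)\cdot\nu\le 0,\quad u\le\psi,\quad (\psi-u)\,m\,D_pH(x,Du)\cdot\nu=0\ \text{ on }\Gamma_D .$$ Then $m\,g(m)+\frac1C(m+1)|Du|^\beta$ is integrable on $\Omega$ and $$\int_\Omega \Bigl[m\,g(m)+\frac{(m+1)|Du|^\beta}{C}\Bigr]\,dx\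 \le\ C_0 .$$ -/

import Mathlib

open MeasureTheory Set
open scoped ENNReal Gradient ContDiff

noncomputable section

namespace MFG

/-- The Euclidean space `ℝ^d`. -/
abbrev Space (d : ℕ) : Type := EuclideanSpace ℝ (Fin d)

/-- The `(d-1)`-dimensional surface measure on subsets of `ℝ^d` (used for `1 ≤ d`): the Hausdorff
measure of dimension `d - 1`, normalized to agree with Lebesgue measure on hyperplanes. -/
def surfaceMeasure (d : ℕ) : Measure (Space d) := μHE[d - 1]

/-- For a unit vector `e`, the function `x ↦ x_e - φ (x')`, where `x_e = ⟨e, x⟩` and `x' = x - x_e e`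
is the orthogonal projection of `x` to the hyperplane `e^⊥`. -/
def graphFun {d : ℕ} (e : Space d) (φ : Space d → ℝ) (x : Space d) : ℝ :=
  inner ℝ e x - φ (x - (inner ℝ e x : ℝ) • e)

/-- In the open neighbourhood `U` of `x₀`, the set `Ω` is the region strictly below the graph of a
`C^1` function over the hyperplane orthogonal to the unit vector `e`. -/
structure IsGraphChart {d : ℕ} (Ω : Set (Space d)) (x₀ : Space d) (U : Set (Space d))
    (e : Space d) (φ : Space d → ℝ) : Prop where
  norm_eq_one : ‖e‖ = 1
  contDiff : ContDiff ℝ 1 φ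
  isOpen : IsOpen U
  mem : x₀ ∈ U
  mem_iff : ∀ x ∈ U, x ∈ Ω ↔ graphFun e φ x < 0

/-- A bounded, open, connected (nonempty) set with `C^1` boundary. -/
structure IsC1Domain {d : ℕ} (Ω : Set (Space d)) : Prop where
  isOpen : IsOpen Ω
  isConnected : IsConnected Ω
  isBounded : Bornology.IsBounded Ω
  exists_chart : ∀ x₀ ∈ frontier Ω, ∃ U e φ, IsGraphChart Ω x₀ U e φ

/-- `ν` is the outward unit normal to `Ω` at the boundary point `x`: the normalized gradient of the
local defining function of a graph chart. -/
def IsOutwardNormal {d : ℕ} (Ω : Set (Space d)) (x ν : Space d) : Prop :=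
  ∃ U e φ, IsGraphChart Ω x U e φ ∧ ν = ‖∇ (graphFun e φ) x‖⁻¹ • ∇ (graphFun e φ) x

/-- The boundary of `Ω` is split into the disjoint, relatively open parts `ΓD` and `ΓN`, up to the
common boundary of these, which has surface measure zero. -/
structure IsBoundaryPartition {d : ℕ} (Ω ΓD ΓN : Set (Space d)) : Prop where
  relOpen_D : ∃ U, IsOpen U ∧ ΓD = U ∩ frontier Ω
  relOpen_N : ∃ U, IsOpen U ∧ ΓN = U ∩ frontier Ω
  disjoint : Disjoint ΓD ΓN
  cover : frontier Ω = closure ΓD ∪ closure ΓN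
  null_inter : surfaceMeasure d (closure ΓD ∩ closure ΓN) = 0

/-- `W` is the weak gradient of `f` on `Ω`. -/
def IsWeakGradient {d : ℕ} (Ω : Set (Space d)) (f : Space d → ℝ) (W : Space d → Space d) : Prop :=
  ∀ η : Space d → ℝ, ContDiff ℝ ∞ η → HasCompactSupport η → tsupport η ⊆ Ω →
    ∀ i : Fin d, ∫ x in Ω, f x * fderiv ℝ η x (EuclideanSpace.single i 1)
      = - ∫ x in Ω, W x i * η x

/-- `f ∈ W^{1,p}(Ω)`. -/
def MemW1 {d : ℕ} (Ω : Set (Space d)) (p : ℝ) (f : Space d → ℝ) : Prop :=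
  MemLp f (ENNReal.ofReal p) (volume.restrict Ω) ∧
    ∃ W : Space d → Space d, MemLp W (ENNReal.ofReal p) (volume.restrict Ω) ∧ IsWeakGradient Ω f W

/-- The divergence `∑ i, ∂_i F_i` of a vector field. -/
def divergence {d : ℕ} (F : Space d → Space d) (x : Space d) : ℝ :=
  ∑ i : Fin d, fderiv ℝ F x (EuclideanSpace.single i 1) i

/-- The assumptions on the coupling `g : [0, ∞) → ℝ`, with exponent `α`, constant `C`, and growth
bounds for arguments `z ≥ z₀`. -/
structure CouplingAssumption (α C z₀ : ℝ) (g : ℝ → ℝ) : Prop where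
  contDiffOn : ContDiffOn ℝ 1 g (Ici 0)
  nonneg : ∀ z, 0 ≤ z → 0 ≤ g z
  monotoneOn : MonotoneOn g (Ici 0)
  lower : ∀ z, 0 ≤ z → z₀ ≤ z → z ^ (1 / (α - 1)) / C ≤ g z
  upper : ∀ z, 0 ≤ z → z₀ ≤ z → g z ≤ C * (z ^ (1 / (α - 1)) + 1)

/-- The assumptions on the Hamiltonian `H : closure Ω × ℝ^d → ℝ`, with exponent `β` and constant
`C`. Here `∇ (H x) p` is `D_p H (x, p)`. -/
structure HamiltonianAssumption {d : ℕ} (Ω : Set (Space d)) (β C : ℝ)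
    (H : Space d → Space d → ℝ) : Prop where
  contDiffOn : ContDiffOn ℝ 2 (fun q : Space d × Space d => H q.1 q.2) (closure Ω ×ˢ univ)
  bddBelow : ∃ b : ℝ, ∀ x ∈ closure Ω, ∀ p, b ≤ H x p
  strictConvexOn : ∀ x ∈ Ω, StrictConvexOn ℝ univ (H x)
  lower : ∀ x ∈ Ω, ∀ p, ‖p‖ ^ β / C - C ≤ H x p
  upper : ∀ x ∈ Ω, ∀ p, H x p ≤ C * (‖p‖ ^ β + 1)
  bound_Dx : ∀ x ∈ Ω, ∀ p, ‖∇ (fun y => H y p) x‖ ≤ C * (‖p‖ ^ β + 1)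
  bound_Dp : ∀ x ∈ Ω, ∀ p, ‖∇ (H x) p‖ ≤ C * (‖p‖ ^ (β - 1) + 1)
  lagrangian_lower : ∀ x ∈ Ω, ∀ p, ‖p‖ ^ β / C - C ≤ - H x p + inner ℝ (∇ (H x) p) p

/-- The boundary conditions, for `m`, `u` and the boundary values `P` of the gradient of `u`; they
are required almost everywhere for the surface measure. -/
structure BoundaryConditions {d : ℕ} (Ω ΓD ΓN : Set (Space d)) (H : Space d → Space d → ℝ)
    (j ψ m u : Space d → ℝ) (P : Space d → Space d) : Prop where
  neumann : ∀ᵐ x ∂(surfaceMeasure d).restrict ΓN, ∀ ν, IsOutwardNormal Ω x ν →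
    m x * inner ℝ (∇ (H x) (P x)) ν = j x
  outflow : ∀ᵐ x ∂(surfaceMeasure d).restrict ΓD, ∀ ν, IsOutwardNormal Ω x ν →
    m x * inner ℝ (∇ (H x) (P x)) ν ≤ 0
  exit_cost : ∀ᵐ x ∂(surfaceMeasure d).restrict ΓD, u x ≤ ψ x
  contact : ∀ᵐ x ∂(surfaceMeasure d).restrict ΓD, ∀ ν, IsOutwardNormal Ω x ν →
    (ψ x - u x) * (m x * inner ℝ (∇ (H x) (P x)) ν) = 0

/-- `(m, u)` is a classical solution of the mean-field game: `m ∈ C^1(Ω) ∩ C(closure Ω)`, `m ≥ 0`,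
`u ∈ C^2(Ω) ∩ C^1(closure Ω)`, both equations hold at every point of `Ω`, and the boundary
conditions hold. The function `P` is the continuous extension of `Du` to `closure Ω`. -/
structure IsClassicalSolution {d : ℕ} (Ω ΓD ΓN : Set (Space d)) (g : ℝ → ℝ)
    (H : Space d → Space d → ℝ) (j ψ m u : Space d → ℝ) : Prop where
  contDiffOn_m : ContDiffOn ℝ 1 m Ω
  continuousOn_m : ContinuousOn m (closure Ω)
  nonneg_m : ∀ x ∈ Ω, 0 ≤ m x
  contDiffOn_u : ContDiffOn ℝ 2 u Ω
  continuousOn_u : ContinuousOn u (closure Ω)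
  hamiltonJacobi : ∀ x ∈ Ω, H x (∇ u x) = g (m x)
  transport : ∀ x ∈ Ω, - divergence (fun y => m y • ∇ (H y) (∇ u y)) x = 0
  boundary : ∃ P : Space d → Space d, ContinuousOn P (closure Ω) ∧ (∀ x ∈ Ω, P x = ∇ u x) ∧
    BoundaryConditions Ω ΓD ΓN H j ψ m u P

end MFG

end

/-!
The energy estimate comes from testing the transport equation with `u - ψ`, which produces the
boundary term `∫ j (u - ψ)` over `ΓN`. To control that term by `∫ |D(u - ψ)|` one needs a bounded
solenoidal field `G` on `Ω` with normal component `j` on `ΓN` and nonpositive normal component on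
`ΓD`. Such a field may depend on the data only, and it exists as soon as the problem is solvable for
one admissible pair `(g, H)`: it is the flux of any one solution. The flux `F = m D_pH(x, Du)` of
any other solution then satisfies `∫ ⟪F - G, Du - Dψ⟫ ≤ 0`, in which the Lagrangian bound makes
`⟪F, Du⟫` dominate the energy, and Young's inequality absorbs the remaining terms.
-/

noncomputable section

namespace MFG

open Filter Topology

variable {d : ℕ} {Ω : Set (Space d)}

theorem nonpos_of_forall_pos_le_mul {a M : ℝ} (h : ∀ δ > 0, a ≤ δ * M) : a ≤ 0 := by
  have hlim : Tendsto (fun δ : ℝ => δ * M) (𝓝[>] 0) (𝓝 0) :=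
    ((continuous_mul_const M).tendsto' 0 0 (zero_mul M)).mono_left nhdsWithin_le_nhds
  exact ge_of_tendsto hlim (eventually_mem_nhdsWithin.mono h)

/-! ### Weak gradients -/

section Mollification

variable {E F : Type*} [NormedAddCommGroup E] [NormedSpace ℝ E] [FiniteDimensional ℝ E]
  [NormedAddCommGroup F] [NormedSpace ℝ F] {η : E → F}

theorem support_normed_convolution_subset [MeasurableSpace E] [BorelSpace E] (μ : Measure E)
    [IsLocallyFiniteMeasure μ] [μ.IsOpenPosMeasure] (φ : ContDiffBump (0 : E)) (η : E → F) :
    Function.support (convolution (φ.normed μ) η (ContinuousLinearMap.lsmul ℝ ℝ) μ) ⊆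
      Metric.cthickening φ.rOut (tsupport η) := by
  refine (support_convolution_subset (L := ContinuousLinearMap.lsmul ℝ ℝ)).trans ?_
  rintro _ ⟨a, ha, b, hb, rfl⟩
  rw [φ.support_normed_eq, mem_ball_zero_iff] at ha
  refine Metric.mem_cthickening_of_dist_le _ b _ _ (subset_tsupport _ hb) ?_
  simpa [dist_eq_norm] using ha.le

theorem fderiv_normed_convolution [MeasurableSpace E] [BorelSpace E] (μ : Measure E)
    [μ.IsAddHaarMeasure] (φ : ContDiffBump (0 : E)) (hη : ContDiff ℝ 1 η)
    (hc : HasCompactSupport η) (x : E) :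
    fderiv ℝ (convolution (φ.normed μ) η (ContinuousLinearMap.lsmul ℝ ℝ) μ) x =
      convolution (φ.normed μ) (fderiv ℝ η) (ContinuousLinearMap.lsmul ℝ ℝ) μ x :=
  (hc.hasFDerivAt_convolution_right (ContinuousLinearMap.lsmul ℝ ℝ)
    φ.continuous_normed.locallyIntegrable hη x).fderiv

theorem exists_contDiff_approx [CompleteSpace F] {Ω : Set E} (hΩ : IsOpen Ω)
    (hη : ContDiff ℝ 1 η) (hc : HasCompactSupport η) (hs : tsupport η ⊆ Ω)
    {ε : ℝ} (hε : 0 < ε) :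
    ∃ θ : E → F, ContDiff ℝ ∞ θ ∧ HasCompactSupport θ ∧ tsupport θ ⊆ Ω ∧
      (∀ x, ‖θ x - η x‖ ≤ ε) ∧ ∀ x, ‖fderiv ℝ θ x - fderiv ℝ η x‖ ≤ ε := by
  borelize E
  let μ : Measure E := Measure.addHaar
  have hη' : Continuous (fderiv ℝ η) := hη.continuous_fderiv one_ne_zero
  obtain ⟨r₁, hr₁, h₁⟩ := Metric.uniformContinuous_iff.1
    (hη.continuous.uniformContinuous_of_tendsto_cocompact hc.is_zero_at_infty) ε hε
  obtain ⟨r₂, hr₂, h₂⟩ := Metric.uniformContinuous_iff.1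
    (hη'.uniformContinuous_of_tendsto_cocompact (hc.fderiv ℝ).is_zero_at_infty) ε hε
  obtain ⟨r₃, hr₃, h₃⟩ := IsCompact.exists_cthickening_subset_open hc hΩ hs
  obtain ⟨r, hr, hrlt⟩ := exists_between (show 0 < min r₁ (min r₂ r₃) by positivity)
  simp only [lt_min_iff] at hrlt
  let φ : ContDiffBump (0 : E) := ⟨r / 2, r, half_pos hr, half_lt_self hr⟩
  have hsupp := support_normed_convolution_subset μ φ η
  refine ⟨convolution (φ.normed μ) η (ContinuousLinearMap.lsmul ℝ ℝ) μ, ?_, ?_, ?_, fun x => ?_,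
    fun x => ?_⟩
  · exact φ.hasCompactSupport_normed.contDiff_convolution_left _ φ.contDiff_normed
      hη.continuous.locallyIntegrable
  · exact HasCompactSupport.of_support_subset_isCompact hc.cthickening hsupp
  · exact (closure_minimal hsupp Metric.isClosed_cthickening).trans
      ((Metric.cthickening_mono hrlt.2.2.le _).trans h₃)
  · rw [← dist_eq_norm]
    exact φ.dist_normed_convolution_le hη.continuous.aestronglyMeasurable
      fun y hy => (h₁ (lt_trans hy hrlt.1)).le
  · rw [fderiv_normed_convolution μ φ hη hc, ← dist_eq_norm]
    exact φ.dist_normed_convolution_le hη'.aestronglyMeasurable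
      fun y hy => (h₂ (lt_trans hy hrlt.2.1)).le

end Mollification

section Integrals

variable {X : Type*} [MeasurableSpace X] {μ : Measure X}

theorem integrable_mul_of_hasCompactSupport [TopologicalSpace X] [OpensMeasurableSpace X]
    {f g : X → ℝ} (hf : Integrable f μ) (hg : Continuous g) (hc : HasCompactSupport g) :
    Integrable (fun x => f x * g x) μ :=
  let ⟨_, hK⟩ := hc.exists_bound_of_continuous hg
  hf.mul_bdd hg.aestronglyMeasurable (ae_of_all _ hK)

theorem abs_integral_mul_sub_integral_mul_le {f g h : X → ℝ} (hf : Integrable f μ)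
    (hg : Integrable (fun x => f x * g x) μ) (hh : Integrable (fun x => f x * h x) μ)
    {ε : ℝ} (hε : ∀ x, |g x - h x| ≤ ε) :
    |(∫ x, f x * g x ∂μ) - ∫ x, f x * h x ∂μ| ≤ ε * ∫ x, |f x| ∂μ := by
  rw [← integral_sub hg hh, ← integral_const_mul, ← Real.norm_eq_abs]
  refine norm_integral_le_of_norm_le (hf.abs.const_mul ε) (ae_of_all _ fun x => ?_)
  rw [← mul_sub, norm_mul, mul_comm ε]
  exact mul_le_mul_of_nonneg_left (hε x) (norm_nonneg _)

end Integrals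

theorem integrableOn_apply {W : Space d → Space d} (hW : IntegrableOn W Ω) (i : Fin d) :
    IntegrableOn (fun x => W x i) Ω :=
  (EuclideanSpace.proj (𝕜 := ℝ) i).integrable_comp hW

theorem integrableOn_mul_fderiv {f η : Space d → ℝ} (hf : IntegrableOn f Ω) (hη : ContDiff ℝ 1 η)
    (hc : HasCompactSupport η) (v : Space d) :
    IntegrableOn (fun x => f x * fderiv ℝ η x v) Ω :=
  integrable_mul_of_hasCompactSupport hf
    ((hη.continuous_fderiv one_ne_zero).clm_apply continuous_const) (hc.fderiv_apply ℝ v)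

theorem IsWeakGradient.sub {f g : Space d → ℝ} {V W : Space d → Space d}
    (hf : IsWeakGradient Ω f V) (hg : IsWeakGradient Ω g W) (hfi : IntegrableOn f Ω)
    (hgi : IntegrableOn g Ω) (hV : IntegrableOn V Ω) (hW : IntegrableOn W Ω) :
    IsWeakGradient Ω (fun x => f x - g x) (fun x => V x - W x) := by
  intro η hη hc hs i
  have hη1 : ContDiff ℝ 1 η := hη.of_le (by exact_mod_cast le_top)
  have hVη := integrable_mul_of_hasCompactSupport (integrableOn_apply hV i) hη.continuous hc
  have hWη := integrable_mul_of_hasCompactSupport (integrableOn_apply hW i) hη.continuous hc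
  simp only [PiLp.sub_apply, sub_mul]
  rw [integral_sub (integrableOn_mul_fderiv hfi hη1 hc _) (integrableOn_mul_fderiv hgi hη1 hc _),
    integral_sub hVη hWη, hf η hη hc hs i, hg η hη hc hs i, neg_sub_neg, neg_sub]

theorem IsWeakGradient.integral_mul_fderiv {f : Space d → ℝ} {W : Space d → Space d}
    (h : IsWeakGradient Ω f W) (hΩ : IsOpen Ω) (hf : IntegrableOn f Ω) (hW : IntegrableOn W Ω)
    {η : Space d → ℝ} (hη : ContDiff ℝ 1 η) (hc : HasCompactSupport η) (hs : tsupport η ⊆ Ω)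
    (i : Fin d) :
    ∫ x in Ω, f x * fderiv ℝ η x (EuclideanSpace.single i 1) = - ∫ x in Ω, W x i * η x := by
  rw [← add_eq_zero_iff_eq_neg, ← abs_nonpos_iff]
  refine nonpos_of_forall_pos_le_mul (M := (∫ x in Ω, |f x|) + ∫ x in Ω, |W x i|) fun ε hε => ?_
  obtain ⟨θ, hθ, hθc, hθs, hθη, hdθη⟩ := exists_contDiff_approx hΩ hη hc hs hε
  have hθ1 : ContDiff ℝ 1 θ := hθ.of_le (by exact_mod_cast le_top)
  have hderiv (x) : |fderiv ℝ η x (EuclideanSpace.single i 1) -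
      fderiv ℝ θ x (EuclideanSpace.single i 1)| ≤ ε := by
    rw [abs_sub_comm, ← Real.norm_eq_abs, ← sub_apply]
    simpa using (fderiv ℝ θ x - fderiv ℝ η x).le_of_opNorm_le (hdθη x) (EuclideanSpace.single i 1)
  have hWi := integrableOn_apply hW i
  have hf_le := abs_integral_mul_sub_integral_mul_le hf (integrableOn_mul_fderiv hf hη hc _)
    (integrableOn_mul_fderiv hf hθ1 hθc _) hderiv
  have hW_le := abs_integral_mul_sub_integral_mul_le hWi
    (integrable_mul_of_hasCompactSupport hWi hη.continuous hc)
    (integrable_mul_of_hasCompactSupport hWi hθ.continuous hθc)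
    fun x => (abs_sub_comm _ _).trans_le (hθη x)
  rw [h θ hθ hθc hθs i] at hf_le
  calc |(∫ x in Ω, f x * fderiv ℝ η x (EuclideanSpace.single i 1)) + ∫ x in Ω, W x i * η x|
      ≤ _ := by rw [← sub_neg_eq_add, ← sub_add_sub_cancel]; exact abs_add_le _ _
    _ ≤ _ := add_le_add hf_le ((congrArg _ (by ring)).trans_le hW_le)
    _ = _ := (mul_add _ _ _).symm

theorem contDiff_of_tsupport_subset {E F : Type*} [NormedAddCommGroup E] [NormedSpace ℝ E]
    [NormedAddCommGroup F] [NormedSpace ℝ F] {Ω : Set E} (hΩ : IsOpen Ω) {n : WithTop ℕ∞}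
    {f : E → F} (hf : ContDiffOn ℝ n f Ω) (hs : tsupport f ⊆ Ω) : ContDiff ℝ n f := by
  refine contDiff_iff_contDiffAt.2 fun x => ?_
  by_cases hx : x ∈ tsupport f
  · exact hf.contDiffAt (hΩ.mem_nhds (hs hx))
  · exact contDiffAt_const.congr_of_eventuallyEq (notMem_tsupport_iff_eventuallyEq.1 hx)

theorem gradient_apply (u : Space d → ℝ) (x : Space d) (i : Fin d) :
    ∇ u x i = fderiv ℝ u x (EuclideanSpace.single i 1) := by
  rw [← inner_gradient_left, EuclideanSpace.inner_single_right]
  simp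

theorem isWeakGradient_gradient (hΩ : IsOpen Ω) {u : Space d → ℝ} (hu : ContDiffOn ℝ 1 u Ω) :
    IsWeakGradient Ω u (∇ u) := by
  intro η hη hc hs i
  have hη1 : ContDiff ℝ 1 η := hη.of_le (by exact_mod_cast le_top)
  set v : Space d := EuclideanSpace.single i 1
  have hdη : Continuous fun x => fderiv ℝ η x v :=
    (hη1.continuous_fderiv one_ne_zero).clm_apply continuous_const
  have hdηs : tsupport (fun x => fderiv ℝ η x v) ⊆ Ω := (tsupport_fderiv_apply_subset ℝ v).trans hs
  have hdu : ContinuousOn (fun x => fderiv ℝ u x v) Ω :=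
    (hu.continuousOn_fderiv_of_isOpen hΩ le_rfl).clm_apply continuousOn_const
  have integrable_mul {a b : Space d → ℝ} (ha : ContinuousOn a Ω) (hb : Continuous b)
      (hbc : HasCompactSupport b) (hbs : tsupport b ⊆ Ω) : Integrable fun x => a x * b x :=
    ((ha.mul hb.continuousOn).continuous_of_tsupport_subset hΩ
      ((tsupport_mul_subset_right (f := a)).trans hbs)).integrable_of_hasCompactSupport hbc.mul_left
  have integral_mul {a b : Space d → ℝ} (hbs : tsupport b ⊆ Ω) :
      ∫ x in Ω, a x * b x = ∫ x, a x * b x :=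
    setIntegral_eq_integral_of_forall_compl_eq_zero fun x hx => by
      rw [image_eq_zero_of_notMem_tsupport fun h => hx (hbs h), mul_zero]
  simp only [gradient_apply]
  rw [integral_mul hdηs, integral_mul hs]
  exact integral_mul_fderiv_eq_neg_fderiv_mul_of_integrable
    (integrable_mul hdu hη.continuous hc hs)
    (integrable_mul hu.continuousOn hdη (hc.fderiv_apply ℝ v) hdηs)
    (integrable_mul hu.continuousOn hη.continuous hc hs)
    (fun x hx => (hu.contDiffAt (hΩ.mem_nhds (hs hx))).differentiableAt one_ne_zero)
    (fun x _ => hη1.differentiable one_ne_zero x)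

theorem divergence_congr {F G : Space d → Space d} {x : Space d} (h : F =ᶠ[𝓝 x] G) :
    divergence F x = divergence G x := by
  simp only [divergence, h.fderiv_eq]

theorem divergence_sub {F G : Space d → Space d} {x : Space d} (hF : DifferentiableAt ℝ F x)
    (hG : DifferentiableAt ℝ G x) :
    divergence (fun y => F y - G y) x = divergence F x - divergence G x := by
  simp only [divergence, fderiv_fun_sub hF hG, sub_apply, PiLp.sub_apply,
    Finset.sum_sub_distrib]

theorem divergence_smul {ξ : Space d → ℝ} {G : Space d → Space d} {x : Space d}
    (hξ : DifferentiableAt ℝ ξ x) (hG : DifferentiableAt ℝ G x) :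
    divergence (fun y => ξ y • G y) x = fderiv ℝ ξ x (G x) + ξ x * divergence G x := by
  have hGx : fderiv ℝ ξ x (G x) = ∑ i, fderiv ℝ ξ x (EuclideanSpace.single i 1) * G x i := by
    conv_lhs => rw [← (EuclideanSpace.basisFun (Fin d) ℝ).sum_repr (G x)]
    simp [mul_comm]
  simp only [divergence, fderiv_fun_smul hξ hG, hGx, Finset.mul_sum, ← Finset.sum_add_distrib]
  exact Finset.sum_congr rfl fun i _ => by simp [add_comm]

theorem IsWeakGradient.integral_mul_divergence {f : Space d → ℝ} {W : Space d → Space d}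
    (h : IsWeakGradient Ω f W) (hΩ : IsOpen Ω) (hf : IntegrableOn f Ω) (hW : IntegrableOn W Ω)
    {X : Space d → Space d} (hX : ContDiff ℝ 1 X) (hc : HasCompactSupport X)
    (hs : tsupport X ⊆ Ω) :
    ∫ x in Ω, f x * divergence X x = - ∫ x in Ω, inner ℝ (X x) (W x) := by
  have hXi (i : Fin d) : ContDiff ℝ 1 fun x => X x i := contDiff_euclidean.1 hX i
  have hXc (i : Fin d) : HasCompactSupport fun x => X x i :=
    hc.comp_left (g := fun y : Space d => y i) rfl
  have hXs (i : Fin d) : tsupport (fun x => X x i) ⊆ Ω :=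
    (closure_mono (Function.support_comp_subset (g := fun y : Space d => y i) rfl X)).trans hs
  have hdX (x) (i : Fin d) : fderiv ℝ X x (EuclideanSpace.single i 1) i =
      fderiv ℝ (fun y => X y i) x (EuclideanSpace.single i 1) :=
    (DFunLike.congr_fun ((EuclideanSpace.proj (𝕜 := ℝ) i).hasFDerivAt.comp x
      (hX.differentiable one_ne_zero x).hasFDerivAt).fderiv _).symm
  simp only [divergence, hdX, Finset.mul_sum, PiLp.inner_apply, RCLike.inner_apply, conj_trivial]
  rw [integral_finsetSum _ fun i _ => integrableOn_mul_fderiv hf (hXi i) (hXc i) _,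
    integral_finsetSum _ fun i _ => integrable_mul_of_hasCompactSupport (integrableOn_apply hW i)
      (hXi i).continuous (hXc i), ← Finset.sum_neg_distrib]
  exact Finset.sum_congr rfl fun i _ => h.integral_mul_fderiv hΩ hf hW (hXi i) (hXc i) (hXs i) i

theorem IsWeakGradient.integral_mul_fderiv_of_divergence_eq_zero {f : Space d → ℝ}
    {W G : Space d → Space d} (h : IsWeakGradient Ω f W) (hΩ : IsOpen Ω) (hf : IntegrableOn f Ω)
    (hW : IntegrableOn W Ω) (hG : ContDiffOn ℝ 1 G Ω) (hdiv : ∀ x ∈ Ω, divergence G x = 0)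
    {ξ : Space d → ℝ} (hξ : ContDiff ℝ 1 ξ) (hc : HasCompactSupport ξ) (hs : tsupport ξ ⊆ Ω) :
    ∫ x in Ω, f x * fderiv ℝ ξ x (G x) = - ∫ x in Ω, ξ x * inner ℝ (G x) (W x) := by
  have hξGs : tsupport (fun x => ξ x • G x) ⊆ Ω := (tsupport_smul_subset_left ξ G).trans hs
  have hdivξG (x) (hx : x ∈ Ω) : divergence (fun y => ξ y • G y) x = fderiv ℝ ξ x (G x) := by
    rw [divergence_smul (hξ.differentiable one_ne_zero x)
      ((hG.contDiffAt (hΩ.mem_nhds hx)).differentiableAt one_ne_zero), hdiv x hx, mul_zero,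
      add_zero]
  have key := h.integral_mul_divergence hΩ hf hW (X := fun x => ξ x • G x)
    (contDiff_of_tsupport_subset hΩ (hξ.contDiffOn.smul hG) hξGs) hc.smul_right hξGs
  simp only [real_inner_smul_left] at key
  rw [← key]
  exact setIntegral_congr_fun hΩ.measurableSet fun x hx => by simp only [hdivξG x hx]

/-! ### Graph charts and the surface measure -/

section GraphFun

variable {e : Space d} {φ : Space d → ℝ}

theorem contDiff_graphFun {n : WithTop ℕ∞} (hφ : ContDiff ℝ n φ) : ContDiff ℝ n (graphFun e φ) := by
  have he : ContDiff ℝ n fun x : Space d => inner ℝ e x := contDiff_const.inner ℝ contDiff_id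
  exact he.sub (hφ.comp (contDiff_id.sub (he.smul contDiff_const)))

theorem graphFun_add_smul (he : ‖e‖ = 1) (φ : Space d → ℝ) (x : Space d) (t : ℝ) :
    graphFun e φ (x + t • e) = graphFun e φ x + t := by
  have hinner : inner ℝ e (x + t • e) = inner ℝ e x + t := by
    rw [inner_add_right, inner_smul_right, inner_self_eq_one_of_norm_eq_one he, mul_one]
  rw [graphFun, graphFun, hinner, add_smul, add_sub_add_right_eq_sub]
  ring

theorem fderiv_graphFun_self (he : ‖e‖ = 1) (hφ : ContDiff ℝ 1 φ) (x : Space d) :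
    fderiv ℝ (graphFun e φ) x e = 1 := by
  have hline : HasLineDerivAt ℝ (graphFun e φ) 1 x e := by
    simpa only [HasLineDerivAt, graphFun_add_smul he] using (hasDerivAt_id' (0 : ℝ)).const_add _
  exact ((contDiff_graphFun hφ).differentiable one_ne_zero x).hasFDerivAt.hasLineDerivAt e
    |>.unique hline

theorem gradient_graphFun_ne_zero (he : ‖e‖ = 1) (hφ : ContDiff ℝ 1 φ) (x : Space d) :
    ∇ (graphFun e φ) x ≠ 0 := fun h => by
  simpa [← inner_gradient_left, h] using fderiv_graphFun_self he hφ x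

/-- The unit normal, pointing upwards, of the level sets of `graphFun e φ`. -/
def graphNormal (e : Space d) (φ : Space d → ℝ) (x : Space d) : Space d :=
  ‖∇ (graphFun e φ) x‖⁻¹ • ∇ (graphFun e φ) x

theorem continuous_graphNormal (he : ‖e‖ = 1) (hφ : ContDiff ℝ 1 φ) :
    Continuous (graphNormal e φ) := by
  have hgrad : Continuous (∇ (graphFun e φ)) :=
    (InnerProductSpace.toDual ℝ (Space d)).symm.continuous.comp
      ((contDiff_graphFun hφ).continuous_fderiv one_ne_zero)
  exact (hgrad.norm.inv₀ fun x => norm_ne_zero_iff.2 (gradient_graphFun_ne_zero he hφ x)).smul hgrad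

theorem fderiv_graphFun_eq_norm_mul_inner (he : ‖e‖ = 1) (hφ : ContDiff ℝ 1 φ) (x v : Space d) :
    fderiv ℝ (graphFun e φ) x v = ‖∇ (graphFun e φ) x‖ * inner ℝ v (graphNormal e φ x) := by
  rw [graphNormal, inner_smul_right, mul_inv_cancel_left₀
    (norm_ne_zero_iff.2 (gradient_graphFun_ne_zero he hφ x)), real_inner_comm, inner_gradient_left]

/-- The parametrization of the graph of `φ` by the hyperplane orthogonal to `e`. -/
def graphMap (e : Space d) (φ : Space d → ℝ) (y : (ℝ ∙ e)ᗮ) : Space d := y + φ y • e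

theorem continuous_graphMap (hφ : Continuous φ) : Continuous (graphMap e φ) :=
  continuous_subtype_val.add ((hφ.comp continuous_subtype_val).smul continuous_const)

theorem orthogonalProjectionOnto_graphMap (y : (ℝ ∙ e)ᗮ) :
    (ℝ ∙ e)ᗮ.orthogonalProjectionOnto (graphMap e φ y) = y := by
  simp [graphMap, Submodule.orthogonalProjectionOnto_orthogonal_apply_eq_zero
    (Submodule.mem_span_singleton_self e)]

theorem graphFun_graphMap (he : ‖e‖ = 1) (y : (ℝ ∙ e)ᗮ) : graphFun e φ (graphMap e φ y) = 0 := by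
  have hy : inner ℝ e (y : Space d) = 0 :=
    Submodule.mem_orthogonal_singleton_iff_inner_right.1 y.2
  rw [graphMap, graphFun_add_smul he, graphFun, hy, zero_smul, sub_zero, zero_sub, neg_add_cancel]

theorem graphMap_orthogonalProjectionOnto (he : ‖e‖ = 1) {x : Space d} (hx : graphFun e φ x = 0) :
    graphMap e φ ((ℝ ∙ e)ᗮ.orthogonalProjectionOnto x) = x := by
  have hproj : ((ℝ ∙ e)ᗮ.orthogonalProjectionOnto x : Space d) = x - (inner ℝ e x : ℝ) • e := by
    rw [← Submodule.starProjection_apply, Submodule.starProjection_orthogonal_val,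
      Submodule.starProjection_unit_singleton ℝ he]
  rw [graphMap, hproj, ← sub_eq_zero.1 hx, sub_add_cancel]

end GraphFun

section GraphChart

variable {U : Set (Space d)} {e : Space d} {φ : Space d → ℝ} {x x₀ : Space d}

theorem IsGraphChart.of_mem (h : IsGraphChart Ω x₀ U e φ) (hx : x ∈ U) : IsGraphChart Ω x U e φ :=
  { h with mem := hx }

theorem IsGraphChart.isOutwardNormal (h : IsGraphChart Ω x₀ U e φ) :
    IsOutwardNormal Ω x₀ (graphNormal e φ x₀) :=
  ⟨U, e, φ, h, rfl⟩

theorem IsGraphChart.mem_frontier (h : IsGraphChart Ω x₀ U e φ) (hΩ : IsOpen Ω) (hxU : x ∈ U)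
    (hx : graphFun e φ x = 0) : x ∈ frontier Ω := by
  have hxΩ : x ∉ Ω := fun hxΩ => ((h.mem_iff x hxU).1 hxΩ).ne hx
  refine hΩ.frontier_eq ▸ ⟨?_, hxΩ⟩
  have hlim : Tendsto (fun t : ℝ => x + t • e) (𝓝[<] 0) (𝓝 x) :=
    ((continuous_const.add (continuous_id.smul continuous_const)).tendsto' 0 x
      (by simp)).mono_left nhdsWithin_le_nhds
  refine mem_closure_of_tendsto hlim ?_
  filter_upwards [hlim (h.isOpen.mem_nhds hxU), self_mem_nhdsWithin] with t htU ht
  rwa [h.mem_iff _ htU, graphFun_add_smul h.norm_eq_one, hx, zero_add]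

theorem IsGraphChart.graphFun_eq_zero (h : IsGraphChart Ω x₀ U e φ) (hΩ : IsOpen Ω) (hxU : x ∈ U)
    (hx : x ∈ frontier Ω) : graphFun e φ x = 0 := by
  rw [hΩ.frontier_eq] at hx
  refine le_antisymm (not_lt.1 fun hpos => ?_)
    (not_lt.1 fun hneg => hx.2 ((h.mem_iff x hxU).2 hneg))
  have hopen : IsOpen (U ∩ {y | 0 < graphFun e φ y}) :=
    h.isOpen.inter (isOpen_lt continuous_const (contDiff_graphFun h.contDiff).continuous)
  obtain ⟨y, ⟨hyU, hy⟩, hyΩ⟩ := mem_closure_iff.1 hx.1 _ hopen ⟨hxU, hpos⟩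
  exact lt_asymm hy ((h.mem_iff y hyU).1 hyΩ)

end GraphChart

theorem euclideanHausdorffMeasure_ne_zero_of_interior_image_orthogonalProjectionOnto {E : Type*}
    [NormedAddCommGroup E] [InnerProductSpace ℝ E] [MeasurableSpace E] [BorelSpace E]
    (K : Submodule ℝ E) [FiniteDimensional ℝ K] {A : Set E}
    (hA : (interior (K.orthogonalProjectionOnto '' A)).Nonempty) :
    (μHE[Module.finrank ℝ K] : Measure E) A ≠ 0 := by
  intro hzero
  have hscalar := Measure.addHaarScalarFactor_volume_hausdorffMeasure_ne_zero (Module.finrank ℝ K)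
  have hμH : μH[Module.finrank ℝ K] A = 0 := by
    rw [Measure.euclideanHausdorffMeasure_def, Measure.smul_apply] at hzero
    simpa [hscalar] using hzero
  have hproj : (μHE[Module.finrank ℝ K] : Measure K) (K.orthogonalProjectionOnto '' A) = 0 := by
    rw [Measure.euclideanHausdorffMeasure_def, Measure.smul_apply,
      le_zero_iff.1 ((hausdorffMeasure_orthogonalProjectionOnto_le K _ A
        (Nat.cast_nonneg _)).trans hμH.le), smul_zero]
  exact isOpen_interior.measure_ne_zero _ hA (measure_mono_null interior_subset hproj)

theorem IsGraphChart.surfaceMeasure_ne_zero {U : Set (Space d)} {e : Space d} {φ : Space d → ℝ}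
    {x₀ : Space d} (h : IsGraphChart Ω x₀ U e φ) (hΩ : IsOpen Ω) (hx₀ : x₀ ∈ frontier Ω)
    {O : Set (Space d)} (hO : IsOpen O) (hx₀O : x₀ ∈ O) :
    surfaceMeasure d (O ∩ frontier Ω) ≠ 0 := by
  have he : e ≠ 0 := norm_ne_zero_iff.1 (h.norm_eq_one ▸ one_ne_zero)
  have hd : 0 < d := by
    by_contra! hd
    obtain rfl : d = 0 := by lia
    exact he (Subsingleton.elim _ _)
  have hfinrank : Module.finrank ℝ (ℝ ∙ e)ᗮ = d - 1 := by
    have : Fact (Module.finrank ℝ (Space d) = d - 1 + 1) := ⟨by simp; lia⟩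
    exact Submodule.finrank_orthogonal_span_singleton he
  have hsub : graphMap e φ ⁻¹' (O ∩ U) ⊆ (ℝ ∙ e)ᗮ.orthogonalProjectionOnto '' (O ∩ frontier Ω) :=
    fun y hy => ⟨graphMap e φ y, ⟨hy.1, h.mem_frontier hΩ hy.2 (graphFun_graphMap h.norm_eq_one y)⟩,
      orthogonalProjectionOnto_graphMap y⟩
  have hmem : graphMap e φ ((ℝ ∙ e)ᗮ.orthogonalProjectionOnto x₀) ∈ O ∩ U := by
    rw [graphMap_orthogonalProjectionOnto h.norm_eq_one (h.graphFun_eq_zero hΩ h.mem hx₀)]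
    exact ⟨hx₀O, h.mem⟩
  rw [surfaceMeasure, ← hfinrank]
  exact euclideanHausdorffMeasure_ne_zero_of_interior_image_orthogonalProjectionOnto _
    ⟨_, interior_maximal hsub
      ((hO.inter h.isOpen).preimage (continuous_graphMap h.contDiff.continuous)) hmem⟩

/-- Near each of its boundary points, `Ω` is the region below the graph of a `C^1` function. This is
the regularity part of `IsC1Domain`. -/
def HasC1Boundary (Ω : Set (Space d)) : Prop :=
  ∀ x₀ ∈ frontier Ω, ∃ U e φ, IsGraphChart Ω x₀ U e φ

theorem HasC1Boundary.closure_subset_of_ae_mem (h : HasC1Boundary Ω) (hΩ : IsOpen Ω)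
    {S T : Set (Space d)} (hS : ∃ O, IsOpen O ∧ S = O ∩ frontier Ω) (hT : IsClosed T)
    (hST : ∀ᵐ x ∂(surfaceMeasure d).restrict S, x ∈ T) : closure S ⊆ T := by
  obtain ⟨O, hO, rfl⟩ := hS
  rw [ae_restrict_iff' (hO.measurableSet.inter isClosed_frontier.measurableSet)] at hST
  refine closure_minimal (fun x hx => by_contra fun hxT => ?_) hT
  obtain ⟨U, e, φ, hch⟩ := h x hx.2
  refine hch.surfaceMeasure_ne_zero hΩ hx.2 (hO.inter hT.isOpen_compl) ⟨hx.1, hxT⟩ ?_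
  exact measure_mono_null (t := {y | ¬(y ∈ O ∩ frontier Ω → y ∈ T)})
    (fun y hy hyT => hy.1.2 (hyT ⟨hy.1.1, hy.2⟩)) hST

/-! ### Integration by parts up to the boundary -/

section LevelCutoff

/-- A smooth cutoff that vanishes above the level `-1 / n` of `q` and equals one below the level
`-2 / n`. -/
def levelCutoff {E : Type*} (q : E → ℝ) (n : ℝ) (x : E) : ℝ :=
  Real.smoothTransition (-(n * q x) - 1)

/-- The density of `-D (levelCutoff q n)` with respect to `Dq`; as `n → ∞` it concentrates on the
level set `q = 0`. -/
def levelDensity {E : Type*} (q : E → ℝ) (n : ℝ) (x : E) : ℝ :=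
  n * deriv Real.smoothTransition (-(n * q x) - 1)

variable {E : Type*} {q : E → ℝ} {n : ℝ} {x : E}

theorem levelCutoff_nonneg : 0 ≤ levelCutoff q n x := Real.smoothTransition.nonneg _

theorem levelCutoff_le_one : levelCutoff q n x ≤ 1 := Real.smoothTransition.le_one _

theorem levelCutoff_eq_one (h : n * q x ≤ -2) : levelCutoff q n x = 1 :=
  Real.smoothTransition.one_of_one_le (by linarith)

theorem levelCutoff_eq_zero (h : -1 ≤ n * q x) : levelCutoff q n x = 0 :=
  Real.smoothTransition.zero_of_nonpos (by linarith)

theorem levelDensity_nonneg (hn : 0 ≤ n) : 0 ≤ levelDensity q n x :=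
  mul_nonneg hn Real.smoothTransition.monotone.deriv_nonneg

theorem levelDensity_eq_zero (h : n * q x < -2) : levelDensity q n x = 0 := by
  have hone : Real.smoothTransition =ᶠ[𝓝 (-(n * q x) - 1)] fun _ => 1 := by
    filter_upwards [lt_mem_nhds (show 1 < -(n * q x) - 1 by linarith)] with s hs
    exact Real.smoothTransition.one_of_one_le hs.le
  rw [levelDensity, hone.deriv_eq, deriv_const, mul_zero]

theorem continuous_levelDensity [TopologicalSpace E] (hq : Continuous q) :
    Continuous (levelDensity q n) :=
  continuous_const.mul ((Real.smoothTransition.contDiff.continuous_deriv (n := 1) le_rfl).comp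
    ((continuous_const.mul hq).neg.sub continuous_const))

theorem tsupport_levelCutoff_subset [TopologicalSpace E] (hq : Continuous q) :
    tsupport (levelCutoff q n) ⊆ {x | n * q x ≤ -1} :=
  closure_minimal (fun _ hx => le_of_not_gt fun h => hx (levelCutoff_eq_zero h.le))
    (isClosed_le (continuous_const.mul hq) continuous_const)

theorem tendsto_integral_levelCutoff_mul [TopologicalSpace E] [MeasurableSpace E]
    [OpensMeasurableSpace E] {μ : Measure E} (hq : Continuous q) {A : E → ℝ} (hA : Integrable A μ)
    (hqA : ∀ᵐ x ∂μ, 0 ≤ q x → A x = 0) :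
    Tendsto (fun n : ℕ => ∫ x, levelCutoff q n x * A x ∂μ) atTop (𝓝 (∫ x, A x ∂μ)) := by
  have hcont (n : ℕ) : Continuous (levelCutoff q n) :=
    Real.smoothTransition.continuous.comp ((continuous_const.mul hq).neg.sub continuous_const)
  refine tendsto_integral_of_dominated_convergence (fun x => |A x|)
    (fun n => (hcont n).aestronglyMeasurable.mul hA.aestronglyMeasurable) hA.abs
    (fun n => ae_of_all _ fun x => ?_) ?_
  · rw [norm_mul, Real.norm_of_nonneg levelCutoff_nonneg]
    exact mul_le_of_le_one_left (norm_nonneg _) levelCutoff_le_one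
  filter_upwards [hqA] with x hx
  rcases le_or_gt 0 (q x) with hqx | hqx
  · simp only [hx hqx, mul_zero, tendsto_const_nhds]
  have hlevel : Tendsto (fun n : ℕ => (n : ℝ) * q x) atTop atBot :=
    tendsto_natCast_atTop_atTop.atTop_mul_const_of_neg hqx
  refine tendsto_const_nhds.congr' ?_
  filter_upwards [hlevel.eventually_le_atBot (-2)] with n hn
  rw [levelCutoff_eq_one hn, one_mul]

theorem exists_pos_forall_le_neg [TopologicalSpace E] {K : Set E} (hK : IsCompact K)
    (hq : ContinuousOn q K) {f : E → ℝ} (hf : ContinuousOn f K)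
    (hfq : ∀ x ∈ K, 0 ≤ q x → f x ≤ 0) {δ : ℝ} (hδ : 0 < δ) :
    ∃ c > 0, ∀ x ∈ K, δ ≤ f x → q x ≤ -c := by
  have hmax : IsCompact (K ∩ f ⁻¹' Ici δ) := by
    obtain ⟨t, ht, hKt⟩ := (continuousOn_iff_isClosed.1 hf) (Ici δ) isClosed_Ici
    exact inter_comm (f ⁻¹' Ici δ) K ▸ hKt ▸ inter_comm t K ▸ hK.inter_right ht
  rcases (K ∩ f ⁻¹' Ici δ).eq_empty_or_nonempty with hempty | hne
  · exact ⟨1, one_pos, fun x hx hδx => (hempty.le ⟨hx, hδx⟩).elim⟩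
  obtain ⟨y, ⟨hyK, hyδ⟩, hy⟩ := hmax.exists_isMaxOn hne (hq.mono inter_subset_left)
  have hqy : q y < 0 := lt_of_not_ge fun h => (hδ.trans_le hyδ).not_ge (hfq y hyK h)
  exact ⟨-q y, neg_pos.2 hqy, fun x hx hδx => (neg_neg (q y)).symm ▸ hy ⟨hx, hδx⟩⟩

theorem eventually_levelDensity_mul_le [TopologicalSpace E] {K : Set E} (hK : IsCompact K)
    (hq : ContinuousOn q K) {f : E → ℝ} (hf : ContinuousOn f K)
    (hfq : ∀ x ∈ K, 0 ≤ q x → f x ≤ 0) {δ : ℝ} (hδ : 0 < δ) :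
    ∀ᶠ n : ℕ in atTop, ∀ x ∈ K, levelDensity q n x * f x ≤ levelDensity q n x * δ := by
  obtain ⟨c, hc, hqc⟩ := exists_pos_forall_le_neg hK hq hf hfq hδ
  filter_upwards [(tendsto_natCast_atTop_atTop.atTop_mul_const hc).eventually_gt_atTop 2]
    with n hn x hx
  rcases le_total (f x) δ with hfx | hfx
  · exact mul_le_mul_of_nonneg_left hfx (levelDensity_nonneg n.cast_nonneg)
  · have hnq : (n : ℝ) * q x ≤ n * -c := mul_le_mul_of_nonneg_left (hqc x hx hfx) n.cast_nonneg
    rw [levelDensity_eq_zero (by linarith), zero_mul, zero_mul]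

variable [NormedAddCommGroup E] [NormedSpace ℝ E]

theorem contDiff_levelCutoff {k : ℕ∞} (hq : ContDiff ℝ k q) : ContDiff ℝ k (levelCutoff q n) :=
  Real.smoothTransition.contDiff.comp ((contDiff_const.mul hq).neg.sub contDiff_const)

theorem fderiv_levelCutoff (hq : DifferentiableAt ℝ q x) :
    fderiv ℝ (levelCutoff q n) x = -(levelDensity q n x • fderiv ℝ q x) := by
  have hinner : HasFDerivAt (fun y => -(n * q y) - 1) (-(n • fderiv ℝ q x)) x :=
    (hq.hasFDerivAt.const_mul n).neg.sub_const 1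
  have houter : HasDerivAt Real.smoothTransition _ (-(n * q x) - 1) :=
    ((Real.smoothTransition.contDiff (n := 1)).differentiable one_ne_zero _).hasDerivAt
  refine (houter.comp_hasFDerivAt x hinner).fderiv.trans ?_
  rw [smul_neg, smul_smul, mul_comm, levelDensity]

theorem integral_mul_levelDensity_le [FiniteDimensional ℝ E] [MeasurableSpace E] [BorelSpace E]
    {μ : Measure E} [μ.IsAddHaarMeasure] (hq : ContDiff ℝ 1 q) {e : E}
    (hqe : ∀ x, fderiv ℝ q x e = 1) {ζ : E → ℝ} (hζ : ContDiff ℝ 1 ζ) (hc : HasCompactSupport ζ) :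
    ∫ x, ζ x * levelDensity q n x ∂μ ≤ ∫ x, |fderiv ℝ ζ x e| ∂μ := by
  have hθ : ContDiff ℝ 1 (levelCutoff q n) := contDiff_levelCutoff (k := 1) hq
  have hθe (x) : fderiv ℝ (levelCutoff q n) x e = -levelDensity q n x := by
    simp [fderiv_levelCutoff (hq.differentiable one_ne_zero x), hqe]
  have hζe : Continuous fun x => fderiv ℝ ζ x e :=
    (hζ.continuous_fderiv one_ne_zero).clm_apply continuous_const
  have hζec : HasCompactSupport fun x => fderiv ℝ ζ x e := hc.fderiv_apply ℝ e
  have hζeθ : Integrable (fun x => fderiv ℝ ζ x e * levelCutoff q n x) μ :=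
    (hζe.mul hθ.continuous).integrable_of_hasCompactSupport hζec.mul_right
  have hparts : ∫ x, ζ x * levelDensity q n x ∂μ = ∫ x, fderiv ℝ ζ x e * levelCutoff q n x ∂μ := by
    have hζk : Integrable (fun x => ζ x * levelDensity q n x) μ :=
      (hζ.continuous.mul (continuous_levelDensity hq.continuous)).integrable_of_hasCompactSupport
        hc.mul_right
    have := integral_mul_fderiv_eq_neg_fderiv_mul_of_integrable (v := e) hζeθ
      (by simp only [hθe, mul_neg]; exact hζk.neg)
      ((hζ.continuous.mul hθ.continuous).integrable_of_hasCompactSupport hc.mul_right)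
      (fun x _ => hζ.differentiable one_ne_zero x) (fun x _ => hθ.differentiable one_ne_zero x)
    simpa only [hθe, mul_neg, integral_neg, neg_inj] using this
  rw [hparts]
  refine integral_mono hζeθ (hζe.integrable_of_hasCompactSupport hζec).abs fun x => ?_
  calc fderiv ℝ ζ x e * levelCutoff q n x ≤ |fderiv ℝ ζ x e| * 1 :=
        mul_le_mul (le_abs_self _) levelCutoff_le_one levelCutoff_nonneg (abs_nonneg _)
    _ = |fderiv ℝ ζ x e| := mul_one _

end LevelCutoff

/-- A vector field that is continuous up to the boundary and, inside `Ω`, of class `C^1` and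
divergence free. -/
structure IsSolenoidal (Ω : Set (Space d)) (G : Space d → Space d) : Prop where
  continuousOn : ContinuousOn G (closure Ω)
  contDiffOn : ContDiffOn ℝ 1 G Ω
  divergence_eq_zero : ∀ x ∈ Ω, divergence G x = 0

theorem IsSolenoidal.sub {F G : Space d → Space d} (hΩ : IsOpen Ω) (hF : IsSolenoidal Ω F)
    (hG : IsSolenoidal Ω G) : IsSolenoidal Ω fun x => F x - G x where
  continuousOn := hF.continuousOn.sub hG.continuousOn
  contDiffOn := hF.contDiffOn.sub hG.contDiffOn
  divergence_eq_zero x hx := by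
    have hΩx := hΩ.mem_nhds hx
    rw [divergence_sub ((hF.contDiffOn.differentiableOn one_ne_zero).differentiableAt hΩx)
      ((hG.contDiffOn.differentiableOn one_ne_zero).differentiableAt hΩx),
      hF.divergence_eq_zero x hx, hG.divergence_eq_zero x hx, sub_zero]

theorem integrableOn_of_continuousOn_closure {X F : Type*} [MetricSpace X] [ProperSpace X]
    [MeasurableSpace X] [OpensMeasurableSpace X] {μ : Measure X} [IsFiniteMeasureOnCompacts μ]
    [NormedAddCommGroup F] {s : Set X} (hs : Bornology.IsBounded s) {f : X → F}
    (hf : ContinuousOn f (closure s)) : IntegrableOn f s μ :=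
  (hf.integrableOn_compact hs.isCompact_closure).mono_set subset_closure

theorem integrableOn_inner_of_continuousOn_closure {X F : Type*} [MetricSpace X]
    [ProperSpace X] [SecondCountableTopology X] [MeasurableSpace X] [OpensMeasurableSpace X]
    {μ : Measure X} [NormedAddCommGroup F] [InnerProductSpace ℝ F] {s : Set X}
    (hso : IsOpen s) (hs : Bornology.IsBounded s) {G W : X → F}
    (hG : ContinuousOn G (closure s)) (hW : IntegrableOn W s μ) :
    IntegrableOn (fun x => (inner ℝ (G x) (W x) : ℝ)) s μ := by
  obtain ⟨K, hK⟩ := hs.isCompact_closure.exists_bound_of_continuousOn hG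
  have hGm : AEStronglyMeasurable G (μ.restrict s) :=
    (hG.mono subset_closure).aestronglyMeasurable hso.measurableSet
  refine (hW.norm.const_mul K).mono' (hGm.inner hW.aestronglyMeasurable) ?_
  filter_upwards [ae_restrict_mem hso.measurableSet] with x hx
  exact (norm_inner_le_norm _ _).trans
    (mul_le_mul_of_nonneg_right (hK x (subset_closure hx)) (norm_nonneg _))

/-- The integral of `ζ w G · ν` over the boundary of `Ω`, for a solenoidal field `G` and a function
`w` with weak gradient `W`, written as a volume integral by means of the divergence theorem. -/
def weakBoundaryFlux (Ω : Set (Space d)) (w : Space d → ℝ) (W G : Space d → Space d)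
    (ζ : Space d → ℝ) : ℝ :=
  ∫ x in Ω, (ζ x * inner ℝ (G x) (W x) + w x * fderiv ℝ ζ x (G x))

section BoundaryFlux

variable {w ζ : Space d → ℝ} {W G : Space d → Space d}

theorem continuousOn_mul_fderiv_apply {s : Set (Space d)} (hw : ContinuousOn w s)
    (hG : ContinuousOn G s) (hζ : ContDiff ℝ 1 ζ) :
    ContinuousOn (fun x => w x * fderiv ℝ ζ x (G x)) s :=
  hw.mul ((hζ.continuous_fderiv one_ne_zero).continuousOn.clm_apply hG)

theorem integrableOn_weakBoundaryFlux (hΩ : IsOpen Ω) (hb : Bornology.IsBounded Ω)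
    (hw : ContinuousOn w (closure Ω)) (hW : IntegrableOn W Ω) (hG : ContinuousOn G (closure Ω))
    (hζ : ContDiff ℝ 1 ζ) :
    IntegrableOn (fun x => ζ x * inner ℝ (G x) (W x) + w x * fderiv ℝ ζ x (G x)) Ω := by
  have hζG : ContinuousOn (fun x => ζ x • G x) (closure Ω) := hζ.continuous.continuousOn.smul hG
  have hinner := integrableOn_inner_of_continuousOn_closure hΩ hb hζG hW
  simp only [real_inner_smul_left] at hinner
  exact hinner.add
    (integrableOn_of_continuousOn_closure hb (continuousOn_mul_fderiv_apply hw hG hζ))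

theorem weakBoundaryFlux_eq_zero (hΩ : IsOpen Ω) (hb : Bornology.IsBounded Ω)
    (h : IsWeakGradient Ω w W) (hw : ContinuousOn w (closure Ω)) (hW : IntegrableOn W Ω)
    (hG : IsSolenoidal Ω G) (hζ : ContDiff ℝ 1 ζ) (hc : HasCompactSupport ζ)
    (hs : tsupport ζ ⊆ Ω) : weakBoundaryFlux Ω w W G ζ = 0 := by
  have hwDζ : IntegrableOn (fun x => w x * fderiv ℝ ζ x (G x)) Ω :=
    integrableOn_of_continuousOn_closure hb (continuousOn_mul_fderiv_apply hw hG.continuousOn hζ)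
  have hζGW : IntegrableOn (fun x => ζ x * (inner ℝ (G x) (W x) : ℝ)) Ω :=
    ((integrableOn_weakBoundaryFlux hΩ hb hw hW hG.continuousOn hζ).sub hwDζ).congr_fun
      (fun x _ => add_sub_cancel_right _ _) hΩ.measurableSet
  rw [weakBoundaryFlux, integral_add hζGW hwDζ,
    h.integral_mul_fderiv_of_divergence_eq_zero hΩ (integrableOn_of_continuousOn_closure hb hw) hW
      hG.contDiffOn hG.divergence_eq_zero hζ hc hs, add_neg_cancel]

theorem integral_levelCutoff_mul_eq {q : Space d → ℝ} {n : ℝ} (hΩ : IsOpen Ω)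
    (hb : Bornology.IsBounded Ω) (h : IsWeakGradient Ω w W) (hw : ContinuousOn w (closure Ω))
    (hW : IntegrableOn W Ω) (hG : IsSolenoidal Ω G) (hζ : ContDiff ℝ 1 ζ)
    (hc : HasCompactSupport ζ) (hq : ContDiff ℝ 1 q)
    (hs : tsupport (fun x => ζ x * levelCutoff q n x) ⊆ Ω) :
    ∫ x in Ω, levelCutoff q n x * (ζ x * inner ℝ (G x) (W x) + w x * fderiv ℝ ζ x (G x)) =
      ∫ x in Ω, ζ x * levelDensity q n x * (w x * fderiv ℝ q x (G x)) := by
  have hθ : ContDiff ℝ 1 (levelCutoff q n) := contDiff_levelCutoff (k := 1) hq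
  have hξ : ContDiff ℝ 1 fun x => ζ x * levelCutoff q n x := hζ.mul hθ
  have hdξ (x) : fderiv ℝ (fun x => ζ x * levelCutoff q n x) x (G x) =
      levelCutoff q n x * fderiv ℝ ζ x (G x) - ζ x * levelDensity q n x * fderiv ℝ q x (G x) := by
    rw [fderiv_fun_mul (hζ.differentiable one_ne_zero x) (hθ.differentiable one_ne_zero x),
      fderiv_levelCutoff (hq.differentiable one_ne_zero x)]
    simp only [add_apply, smul_apply, neg_apply, smul_eq_mul]
    ring
  have hintegrand (x) : ζ x * levelCutoff q n x * inner ℝ (G x) (W x) +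
      w x * fderiv ℝ (fun x => ζ x * levelCutoff q n x) x (G x) =
        levelCutoff q n x * (ζ x * inner ℝ (G x) (W x) + w x * fderiv ℝ ζ x (G x)) -
          ζ x * levelDensity q n x * (w x * fderiv ℝ q x (G x)) := by
    rw [hdξ]
    ring
  have hbdry : IntegrableOn (fun x => ζ x * levelDensity q n x * (w x * fderiv ℝ q x (G x))) Ω :=
    integrableOn_of_continuousOn_closure hb
      ((hζ.continuous.mul (continuous_levelDensity hq.continuous)).continuousOn.mul
        (continuousOn_mul_fderiv_apply hw hG.continuousOn hq))
  have hbulk : IntegrableOn (fun x =>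
      levelCutoff q n x * (ζ x * inner ℝ (G x) (W x) + w x * fderiv ℝ ζ x (G x))) Ω := by
    have hflux := integrableOn_weakBoundaryFlux hΩ hb hw hW hG.continuousOn hξ
    simp only [hintegrand] at hflux
    exact (hflux.add hbdry).congr_fun (fun x _ => sub_add_cancel _ _) hΩ.measurableSet
  have hzero := weakBoundaryFlux_eq_zero hΩ hb h hw hW hG hξ hc.mul_right hs
  simp only [weakBoundaryFlux, hintegrand] at hzero
  rwa [integral_sub hbulk hbdry, sub_eq_zero] at hzero

theorem IsGraphChart.tsupport_mul_levelCutoff_subset {x₀ : Space d} {U : Set (Space d)}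
    {e : Space d} {φ : Space d → ℝ} (hch : IsGraphChart Ω x₀ U e φ) (hs : tsupport ζ ⊆ U) {n : ℝ}
    (hn : 0 ≤ n) : tsupport (fun x => ζ x * levelCutoff (graphFun e φ) n x) ⊆ Ω := by
  intro x hx
  have hxq : n * graphFun e φ x ≤ -1 :=
    tsupport_levelCutoff_subset (contDiff_graphFun hch.contDiff).continuous
      (tsupport_mul_subset_right (f := ζ) hx)
  rw [hch.mem_iff x (hs (tsupport_mul_subset_left hx))]
  exact lt_of_not_ge fun hq => by linarith [mul_nonneg hn hq]

theorem IsGraphChart.mul_fderiv_graphFun_nonpos {x₀ x v : Space d} {U : Set (Space d)}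
    {e : Space d} {φ : Space d → ℝ} (hch : IsGraphChart Ω x₀ U e φ) (hx : x ∈ U) {a : ℝ}
    (hsign : ∀ ν, IsOutwardNormal Ω x ν → a * inner ℝ v ν ≤ 0) :
    a * fderiv ℝ (graphFun e φ) x v ≤ 0 := by
  rw [fderiv_graphFun_eq_norm_mul_inner hch.norm_eq_one hch.contDiff, mul_left_comm]
  exact mul_nonpos_of_nonneg_of_nonpos (norm_nonneg _)
    (hsign _ (hch.of_mem hx).isOutwardNormal)

theorem IsGraphChart.weakBoundaryFlux_nonpos {x₀ : Space d} {U : Set (Space d)} {e : Space d}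
    {φ : Space d → ℝ} (hch : IsGraphChart Ω x₀ U e φ) (hΩ : IsOpen Ω) (hb : Bornology.IsBounded Ω)
    (h : IsWeakGradient Ω w W) (hw : ContinuousOn w (closure Ω)) (hW : IntegrableOn W Ω)
    (hG : IsSolenoidal Ω G)
    (hsign : ∀ x ∈ frontier Ω, ∀ ν, IsOutwardNormal Ω x ν → w x * inner ℝ (G x) ν ≤ 0)
    (hζ : ContDiff ℝ 1 ζ) (hζ0 : ∀ x, 0 ≤ ζ x) (hc : HasCompactSupport ζ) (hs : tsupport ζ ⊆ U) :
    weakBoundaryFlux Ω w W G ζ ≤ 0 := by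
  set q := graphFun e φ
  have hq : ContDiff ℝ 1 q := contDiff_graphFun hch.contDiff
  have hqe := fderiv_graphFun_self hch.norm_eq_one hch.contDiff
  have hflux := integrableOn_weakBoundaryFlux hΩ hb hw hW hG.continuousOn hζ
  have hf := continuousOn_mul_fderiv_apply hw hG.continuousOn hq
  have hlim := tendsto_integral_levelCutoff_mul hq.continuous hflux <| by
    filter_upwards [ae_restrict_mem hΩ.measurableSet] with x hx hqx
    have hxζ : x ∉ tsupport ζ := fun hxζ => ((hch.mem_iff x (hs hxζ)).1 hx).not_ge hqx
    rw [image_eq_zero_of_notMem_tsupport hxζ,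
      image_eq_zero_of_notMem_tsupport fun hx => hxζ (tsupport_fderiv_subset ℝ hx)]
    simp
  have hfq : ∀ x ∈ closure Ω ∩ tsupport ζ, 0 ≤ q x → w x * fderiv ℝ q x (G x) ≤ 0 :=
    fun x hx hqx => hch.mul_fderiv_graphFun_nonpos (hs hx.2) (hsign x
      ⟨hx.1, fun hxi => ((hch.mem_iff x (hs hx.2)).1 (interior_subset hxi)).not_ge hqx⟩)
  have hK : IsCompact (closure Ω ∩ tsupport ζ) :=
    hb.isCompact_closure.inter_right (isClosed_tsupport ζ)
  refine nonpos_of_forall_pos_le_mul (M := ∫ x, |fderiv ℝ ζ x e|) fun δ hδ => le_of_tendsto hlim ?_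
  filter_upwards [eventually_levelDensity_mul_le hK hq.continuous.continuousOn
    (hf.mono inter_subset_left) hfq hδ] with n hn
  have hζk : Continuous fun x => ζ x * levelDensity q n x :=
    hζ.continuous.mul (continuous_levelDensity hq.continuous)
  have hζki : Integrable fun x => ζ x * levelDensity q n x :=
    hζk.integrable_of_hasCompactSupport hc.mul_right
  have hle : ∀ x ∈ Ω, ζ x * levelDensity q n x * (w x * fderiv ℝ q x (G x)) ≤
      δ * (ζ x * levelDensity q n x) := fun x hx => by
    by_cases hxζ : x ∈ tsupport ζ
    · rw [mul_comm δ, mul_assoc, mul_assoc]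
      exact mul_le_mul_of_nonneg_left (hn x ⟨subset_closure hx, hxζ⟩) (hζ0 x)
    · simp only [image_eq_zero_of_notMem_tsupport hxζ, zero_mul, mul_zero, le_refl]
  rw [integral_levelCutoff_mul_eq hΩ hb h hw hW hG hζ hc hq
    (hch.tsupport_mul_levelCutoff_subset hs n.cast_nonneg)]
  calc ∫ x in Ω, ζ x * levelDensity q n x * (w x * fderiv ℝ q x (G x))
      ≤ ∫ x in Ω, δ * (ζ x * levelDensity q n x) :=
        setIntegral_mono_on (integrableOn_of_continuousOn_closure hb (hζk.continuousOn.mul hf))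
          (hζki.integrableOn.const_mul δ) hΩ.measurableSet hle
    _ = δ * ∫ x in Ω, ζ x * levelDensity q n x := integral_const_mul _ _
    _ ≤ δ * ∫ x, |fderiv ℝ ζ x e| := mul_le_mul_of_nonneg_left
        ((setIntegral_le_integral hζki (ae_of_all _ fun x =>
          mul_nonneg (hζ0 x) (levelDensity_nonneg n.cast_nonneg))).trans
            (integral_mul_levelDensity_le hq hqe hζ hc)) hδ.le

end BoundaryFlux

theorem exists_contDiff_partitionOfUnity {E : Type*} [NormedAddCommGroup E] [NormedSpace ℝ E]
    [FiniteDimensional ℝ E] {K : Set E} (hK : IsCompact K) {V : E → Set E}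
    (hV : ∀ x ∈ K, IsOpen (V x) ∧ x ∈ V x) :
    ∃ (t : Finset E) (ρ : t → E → ℝ), (∀ i, ↑i ∈ K ∧ ContDiff ℝ ∞ (ρ i) ∧ (∀ x, 0 ≤ ρ i x) ∧
      HasCompactSupport (ρ i) ∧ tsupport (ρ i) ⊆ V i) ∧ ∀ x ∈ K, ∑ i, ρ i x = 1 := by
  have : ProperSpace E := FiniteDimensional.proper_real E
  have hball : ∀ x ∈ K, V x ∩ Metric.ball x 1 ∈ 𝓝 x := fun x hx =>
    inter_mem ((hV x hx).1.mem_nhds (hV x hx).2) (Metric.ball_mem_nhds x one_pos)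
  obtain ⟨t, htK, hcov⟩ := hK.elim_nhds_subcover _ hball
  obtain ⟨ρ, hρ⟩ := SmoothPartitionOfUnity.exists_isSubordinate (modelWithCornersSelf ℝ E)
    hK.isClosed (fun i : t => V i ∩ Metric.ball (i : E) 1)
    (fun i => (hV i (htK i i.2)).1.inter Metric.isOpen_ball)
    (hcov.trans (iUnion₂_subset fun x hx => subset_iUnion_of_subset (⟨x, hx⟩ : t) subset_rfl))
  refine ⟨t, fun i => ρ i, fun i => ⟨htK i i.2, contMDiff_iff_contDiff.1 (ρ i).contMDiff,
    ρ.nonneg i, ?_, (hρ i).trans inter_subset_left⟩, fun x hx => ?_⟩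
  · exact Metric.isCompact_of_isClosed_isBounded (isClosed_tsupport _)
      (Metric.isBounded_ball.subset ((hρ i).trans inter_subset_right))
  · rw [← ρ.sum_eq_one hx, finsum_eq_sum_of_fintype]

theorem sum_fderiv_apply_eq_zero {E ι : Type*} [NormedAddCommGroup E] [NormedSpace ℝ E]
    [Fintype ι] {s : Set E} (hs : IsOpen s) {ρ : ι → E → ℝ} (hρ : ∀ i, Differentiable ℝ (ρ i))
    (hsum : ∀ x ∈ s, ∑ i, ρ i x = 1) {x : E} (hx : x ∈ s) (v : E) :
    ∑ i, fderiv ℝ (ρ i) x v = 0 := by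
  have hone : (fun y => ∑ i, ρ i y) =ᶠ[𝓝 x] fun _ => 1 := by
    filter_upwards [hs.mem_nhds hx] with y hy using hsum y hy
  rw [← sum_apply, ← fderiv_fun_sum fun i _ => hρ i x, hone.fderiv_eq, fderiv_const_apply,
    zero_apply]

theorem sum_weakBoundaryFlux {ι : Type*} [Fintype ι] {w : Space d → ℝ} {W G : Space d → Space d}
    {ρ : ι → Space d → ℝ} (hΩ : IsOpen Ω) (hb : Bornology.IsBounded Ω)
    (hw : ContinuousOn w (closure Ω)) (hW : IntegrableOn W Ω) (hG : ContinuousOn G (closure Ω))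
    (hρ : ∀ i, ContDiff ℝ 1 (ρ i)) (hsum : ∀ x ∈ Ω, ∑ i, ρ i x = 1) :
    ∑ i, weakBoundaryFlux Ω w W G (ρ i) = ∫ x in Ω, inner ℝ (G x) (W x) := by
  simp only [weakBoundaryFlux]
  rw [← integral_finsetSum _ fun i _ => integrableOn_weakBoundaryFlux hΩ hb hw hW hG (hρ i)]
  refine setIntegral_congr_fun hΩ.measurableSet fun x hx => ?_
  simp only [Finset.sum_add_distrib, ← Finset.sum_mul, ← Finset.mul_sum, hsum x hx, one_mul,
    sum_fderiv_apply_eq_zero hΩ (fun i => (hρ i).differentiable one_ne_zero) hsum hx, mul_zero,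
    add_zero]

theorem HasC1Boundary.integral_inner_nonpos {w : Space d → ℝ} {W G : Space d → Space d}
    (hΓ : HasC1Boundary Ω) (hΩ : IsOpen Ω) (hb : Bornology.IsBounded Ω)
    (h : IsWeakGradient Ω w W) (hw : ContinuousOn w (closure Ω)) (hW : IntegrableOn W Ω)
    (hG : IsSolenoidal Ω G)
    (hsign : ∀ x ∈ frontier Ω, ∀ ν, IsOutwardNormal Ω x ν → w x * inner ℝ (G x) ν ≤ 0) :
    ∫ x in Ω, inner ℝ (G x) (W x) ≤ 0 := by
  have hloc : ∀ x ∈ closure Ω, ∃ V, (IsOpen V ∧ x ∈ V) ∧ ∀ ζ : Space d → ℝ, ContDiff ℝ 1 ζ →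
      (∀ y, 0 ≤ ζ y) → HasCompactSupport ζ → tsupport ζ ⊆ V → weakBoundaryFlux Ω w W G ζ ≤ 0 := by
    intro x hx
    by_cases hxΩ : x ∈ Ω
    · exact ⟨Ω, ⟨hΩ, hxΩ⟩, fun ζ hζ _ hc hs =>
        (weakBoundaryFlux_eq_zero hΩ hb h hw hW hG hζ hc hs).le⟩
    · obtain ⟨U, e, φ, hch⟩ := hΓ x ⟨hx, hΩ.interior_eq.symm ▸ hxΩ⟩
      exact ⟨U, ⟨hch.isOpen, hch.mem⟩, fun ζ hζ hζ0 hc hs =>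
        hch.weakBoundaryFlux_nonpos hΩ hb h hw hW hG hsign hζ hζ0 hc hs⟩
  choose! V hV hVζ using hloc
  obtain ⟨t, ρ, hρ, hsum⟩ := exists_contDiff_partitionOfUnity hb.isCompact_closure hV
  have hρ1 (i) : ContDiff ℝ 1 (ρ i) := (hρ i).2.1.of_le (by exact_mod_cast le_top)
  rw [← sum_weakBoundaryFlux hΩ hb hw hW hG.continuousOn hρ1
    fun x hx => hsum x (subset_closure hx)]
  exact Finset.sum_nonpos fun i _ =>
    let ⟨hi, _, hi0, hic, his⟩ := hρ i
    hVζ i hi (ρ i) (hρ1 i) hi0 hic his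

/-! ### Admissible fields -/

theorem HasC1Boundary.mul_inner_normal_nonpos (hΓ : HasC1Boundary Ω) (hΩ : IsOpen Ω)
    {S : Set (Space d)} (hS : ∃ O, IsOpen O ∧ S = O ∩ frontier Ω) {a : Space d → ℝ}
    {X : Space d → Space d} (ha : ContinuousOn a (closure Ω)) (hX : ContinuousOn X (closure Ω))
    (hsign : ∀ᵐ x ∂(surfaceMeasure d).restrict S, ∀ ν, IsOutwardNormal Ω x ν →
      a x * inner ℝ (X x) ν ≤ 0)
    {x ν : Space d} (hx : x ∈ closure S) (hν : IsOutwardNormal Ω x ν) :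
    a x * inner ℝ (X x) ν ≤ 0 := by
  obtain ⟨U, e, φ, hch, rfl⟩ := hν
  obtain ⟨O, hO, rfl⟩ := hS
  have hcont : ContinuousOn (fun y => a y * (inner ℝ (X y) (graphNormal e φ y) : ℝ)) (closure Ω) :=
    ha.mul (hX.inner (continuous_graphNormal hch.norm_eq_one hch.contDiff).continuousOn)
  have hclosed := hcont.preimage_isClosed_of_isClosed isClosed_closure isClosed_Iic (t := Iic 0)
  have hsub : closure (O ∩ U ∩ frontier Ω) ⊆ _ :=
    hΓ.closure_subset_of_ae_mem hΩ ⟨O ∩ U, hO.inter hch.isOpen, rfl⟩ hclosed <| by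
      have hmeas : MeasurableSet (O ∩ U ∩ frontier Ω) :=
        (hO.inter hch.isOpen).measurableSet.inter isClosed_frontier.measurableSet
      filter_upwards [ae_restrict_mem hmeas, ae_restrict_of_ae_restrict_of_subset
        (inter_subset_inter_left _ inter_subset_left) hsign] with y hy hyν
      exact ⟨hy.2.1, hyν _ (hch.of_mem hy.1.2).isOutwardNormal⟩
  have hxU : x ∈ closure (O ∩ U ∩ frontier Ω) := by
    rw [inter_right_comm, inter_comm]
    exact hch.isOpen.inter_closure ⟨hch.mem, hx⟩
  exact (hsub hxU).2

/-- The vector fields that compete with the flux `m D_pH(x, Du)` of a solution: solenoidal, with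
normal component `j` on `ΓN`, and pointing inwards along `ΓD`. -/
structure IsAdmissibleField (Ω ΓD ΓN : Set (Space d)) (j : Space d → ℝ)
    (G : Space d → Space d) : Prop extends IsSolenoidal Ω G where
  neumann : ∀ᵐ x ∂(surfaceMeasure d).restrict ΓN, ∀ ν, IsOutwardNormal Ω x ν →
    inner ℝ (G x) ν = j x
  outflow : ∀ᵐ x ∂(surfaceMeasure d).restrict ΓD, ∀ ν, IsOutwardNormal Ω x ν →
    inner ℝ (G x) ν ≤ 0

theorem IsAdmissibleField.integral_inner_sub_nonpos {ΓD ΓN : Set (Space d)}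
    {j ψ u : Space d → ℝ} {F G V W : Space d → Space d} (hF : IsAdmissibleField Ω ΓD ΓN j F)
    (hG : IsAdmissibleField Ω ΓD ΓN j G) (hΩ : IsOpen Ω) (hb : Bornology.IsBounded Ω)
    (hΓ : HasC1Boundary Ω) (hD : ∃ O, IsOpen O ∧ ΓD = O ∩ frontier Ω)
    (hN : ∃ O, IsOpen O ∧ ΓN = O ∩ frontier Ω) (hcover : frontier Ω ⊆ closure ΓD ∪ closure ΓN)
    (hu : ContinuousOn u (closure Ω)) (hV : IsWeakGradient Ω u V) (hVi : IntegrableOn V Ω)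
    (hψ : ContinuousOn ψ (closure Ω)) (hW : IsWeakGradient Ω ψ W) (hWi : IntegrableOn W Ω)
    (hcost : ∀ᵐ x ∂(surfaceMeasure d).restrict ΓD, u x ≤ ψ x)
    (hcontact : ∀ᵐ x ∂(surfaceMeasure d).restrict ΓD, ∀ ν, IsOutwardNormal Ω x ν →
      (ψ x - u x) * inner ℝ (F x) ν = 0) :
    ∫ x in Ω, inner ℝ (F x - G x) (V x - W x) ≤ 0 := by
  have hFG := hF.toIsSolenoidal.sub hΩ hG.toIsSolenoidal
  have hgrad := hV.sub hW (integrableOn_of_continuousOn_closure hb hu)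
    (integrableOn_of_continuousOn_closure hb hψ) hVi hWi
  refine hΓ.integral_inner_nonpos hΩ hb hgrad (hu.sub hψ) (hVi.sub hWi) hFG fun x hx ν hν => ?_
  rcases hcover hx with hxD | hxN
  · refine hΓ.mul_inner_normal_nonpos hΩ hD (hu.sub hψ) hFG.continuousOn ?_ hxD hν
    filter_upwards [hcost, hcontact, hG.outflow] with y hy hFy hGy ν hν
    calc (u y - ψ y) * inner ℝ (F y - G y) ν
        = (ψ y - u y) * inner ℝ (G y) ν - (ψ y - u y) * inner ℝ (F y) ν := by
          rw [inner_sub_left]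
          ring
      _ = (ψ y - u y) * inner ℝ (G y) ν := by rw [hFy ν hν, sub_zero]
      _ ≤ 0 := mul_nonpos_of_nonneg_of_nonpos (sub_nonneg.2 hy) (hGy ν hν)
  · refine hΓ.mul_inner_normal_nonpos hΩ hN (hu.sub hψ) hFG.continuousOn ?_ hxN hν
    filter_upwards [hF.neumann, hG.neumann] with y hFy hGy ν hν
    rw [inner_sub_left, hFy ν hν, hGy ν hν, sub_self, mul_zero]

/-! ### The flux of a solution -/

theorem contDiffOn_gradient_snd {E F : Type*} [NormedAddCommGroup E] [NormedSpace ℝ E]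
    [NormedAddCommGroup F] [InnerProductSpace ℝ F] [CompleteSpace F] {X : Set E} {H : E → F → ℝ}
    (hH : ContDiffOn ℝ 2 (fun q : E × F => H q.1 q.2) (X ×ˢ univ)) :
    ContDiffOn ℝ 1 (fun q : E × F => ∇ (H q.1) q.2) (X ×ˢ univ) := by
  intro q hq
  have hH1 : ContDiffWithinAt ℝ (1 + 1) (fun q : E × F => H q.1 q.2) (X ×ˢ univ) q := by
    rw [one_add_one_eq_two]
    exact hH q hq
  obtain ⟨N, hN, hNX, -, H', hH', hH'1⟩ :=
    (contDiffWithinAt_succ_iff_hasFDerivWithinAt' (by simp)).1 hH1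
  rw [insert_eq_of_mem hq] at hN hNX
  have hgrad : ∀ y ∈ N, ∇ (H y.1) y.2 =
      (InnerProductSpace.toDual ℝ F).symm ((H' y).comp (ContinuousLinearMap.inr ℝ E F)) := by
    intro y hy
    have hslice : HasFDerivWithinAt (fun p : F => (y.1, p)) (ContinuousLinearMap.inr ℝ E F)
        univ y.2 := (hasFDerivAt_prodMk_right y.1 y.2).hasFDerivWithinAt
    have hHy : HasFDerivWithinAt (H y.1) ((H' y).comp (ContinuousLinearMap.inr ℝ E F)) univ y.2 :=
      HasFDerivWithinAt.comp (t := X ×ˢ univ) (g := fun q : E × F => H q.1 q.2) y.2 (hH' y hy)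
        hslice fun p _ => ⟨(hNX hy).1, mem_univ _⟩
    rw [gradient, (hasFDerivWithinAt_univ.1 hHy).fderiv]
  have hcomp := (InnerProductSpace.toDual ℝ F).symm.contDiff.contDiffAt.comp_contDiffWithinAt q
    (hH'1.clm_comp (contDiffWithinAt_const (c := ContinuousLinearMap.inr ℝ E F)))
  exact hcomp.congr_of_eventuallyEq (by filter_upwards [hN] with y hy using hgrad y hy)
    (hgrad q (mem_of_mem_nhdsWithin hq hN))

theorem contDiffOn_gradient {F : Type*} [NormedAddCommGroup F] [InnerProductSpace ℝ F]
    [CompleteSpace F] {s : Set F} (hs : IsOpen s) {u : F → ℝ} (hu : ContDiffOn ℝ 2 u s) :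
    ContDiffOn ℝ 1 (∇ u) s :=
  (InnerProductSpace.toDual ℝ F).symm.contDiff.comp_contDiffOn
    (hu.fderiv_of_isOpen hs (by norm_num [one_add_one_eq_two]))

variable {ΓD ΓN : Set (Space d)} {g : ℝ → ℝ} {H : Space d → Space d → ℝ} {j ψ m u : Space d → ℝ}

theorem IsClassicalSolution.integrableOn_gradient (h : IsClassicalSolution Ω ΓD ΓN g H j ψ m u)
    (hΩ : IsOpen Ω) (hb : Bornology.IsBounded Ω) : IntegrableOn (∇ u) Ω := by
  obtain ⟨P, hP, hPu, -⟩ := h.boundary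
  exact (integrableOn_of_continuousOn_closure hb hP).congr_fun hPu hΩ.measurableSet

theorem IsClassicalSolution.exists_isAdmissibleField
    (h : IsClassicalSolution Ω ΓD ΓN g H j ψ m u) (hΩ : IsOpen Ω)
    (hH : ContDiffOn ℝ 2 (fun q : Space d × Space d => H q.1 q.2) (closure Ω ×ˢ univ)) :
    ∃ F, IsAdmissibleField Ω ΓD ΓN j F ∧ (∀ x ∈ Ω, F x = m x • ∇ (H x) (∇ u x)) ∧
      (∀ᵐ x ∂(surfaceMeasure d).restrict ΓD, u x ≤ ψ x) ∧
      ∀ᵐ x ∂(surfaceMeasure d).restrict ΓD, ∀ ν, IsOutwardNormal Ω x ν →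
        (ψ x - u x) * inner ℝ (F x) ν = 0 := by
  obtain ⟨P, hP, hPu, hbc⟩ := h.boundary
  have hDp := contDiffOn_gradient_snd hH
  have heq : ∀ x ∈ Ω, m x • ∇ (H x) (P x) = m x • ∇ (H x) (∇ u x) := fun x hx => by
    rw [hPu x hx]
  refine ⟨fun x => m x • ∇ (H x) (P x), ⟨⟨?_, ?_, fun x hx => ?_⟩, ?_, ?_⟩, heq, hbc.exit_cost, ?_⟩
  · exact h.continuousOn_m.smul (hDp.continuousOn.comp (continuousOn_id.prodMk hP)
      fun x hx => ⟨hx, mem_univ _⟩)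
  · refine ContDiffOn.congr (h.contDiffOn_m.smul (hDp.comp
      (contDiffOn_id.prodMk (contDiffOn_gradient hΩ h.contDiffOn_u))
      fun x hx => ⟨subset_closure hx, mem_univ _⟩)) heq
  · rw [divergence_congr (eventuallyEq_of_mem (hΩ.mem_nhds hx) heq)]
    exact neg_eq_zero.1 (h.transport x hx)
  · simpa only [real_inner_smul_left] using hbc.neumann
  · simpa only [real_inner_smul_left] using hbc.outflow
  · simpa only [real_inner_smul_left] using hbc.contact

/-! ### The pointwise energy inequality -/

theorem exists_young_le {p q ε : ℝ} (hpq : p.HolderConjugate q) (hε : 0 < ε) :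
    ∃ K : ℝ, 0 ≤ K ∧ ∀ a b : ℝ, 0 ≤ a → 0 ≤ b → a * b ≤ ε * a ^ p + K * b ^ q := by
  set l : ℝ := ε ^ p⁻¹
  have hl0 : 0 < l := Real.rpow_pos_of_pos hε _
  have hlp : l ^ p = ε := Real.rpow_inv_rpow hε.le hpq.ne_zero
  refine ⟨l⁻¹ ^ q, by positivity, fun a b ha hb => ?_⟩
  calc a * b = l * a * (l⁻¹ * b) := by field_simp
    _ ≤ (l * a) ^ p / p + (l⁻¹ * b) ^ q / q :=
      Real.young_inequality_of_nonneg (by positivity) (by positivity) hpq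
    _ ≤ (l * a) ^ p + (l⁻¹ * b) ^ q :=
      add_le_add (div_le_self (by positivity) hpq.lt.le)
        (div_le_self (by positivity) hpq.symm.lt.le)
    _ = ε * a ^ p + l⁻¹ ^ q * b ^ q := by
      rw [Real.mul_rpow hl0.le ha, Real.mul_rpow (by positivity) hb, hlp]

theorem rpow_le_one_add_rpow {x r t : ℝ} (hx : 0 ≤ x) (hr : 0 ≤ r) (hrt : r ≤ t) :
    x ^ r ≤ 1 + x ^ t := by
  rcases le_total x 1 with hx1 | hx1
  · exact (Real.rpow_le_one hx hx1 hr).trans (le_add_of_nonneg_right (by positivity))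
  · exact (Real.rpow_le_rpow_of_exponent_le hx1 hrt).trans (le_add_of_nonneg_left zero_le_one)

variable {α β C z₀ s : ℝ}

theorem CouplingAssumption.rpow_le (h : CouplingAssumption α C z₀ g) (hα : 1 < α) (hC : 0 < C)
    (hs : 0 ≤ s) : s ^ (α / (α - 1)) ≤ C * (s * g s) + |z₀| ^ (α / (α - 1)) := by
  have hα1 : 0 < α - 1 := sub_pos.2 hα
  rcases le_total z₀ s with hz | hz
  · refine le_add_of_le_of_nonneg ?_ (by positivity)
    calc s ^ (α / (α - 1)) = s ^ (1 + 1 / (α - 1)) := by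
          congr 1
          field_simp
          ring
      _ = s * s ^ (1 / (α - 1)) := Real.rpow_one_add' hs (by positivity)
      _ ≤ s * (g s * C) := mul_le_mul_of_nonneg_left ((div_le_iff₀ hC).1 (h.lower s hs hz)) hs
      _ = C * (s * g s) := by ring
  · have hg := h.nonneg s hs
    exact le_add_of_nonneg_of_le (by positivity)
      (Real.rpow_le_rpow hs (hz.trans (le_abs_self z₀)) (by positivity))

theorem CouplingAssumption.le_mul_add (h : CouplingAssumption α C z₀ g) (hs : 0 ≤ s) :
    g s ≤ s * g s + C * (max 1 z₀ ^ (1 / (α - 1)) + 1) := by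
  have hmax : (0 : ℝ) ≤ max 1 z₀ := zero_le_one.trans (le_max_left _ _)
  have hupper := h.upper _ hmax (le_max_right _ _)
  have hgs := h.nonneg s hs
  rcases le_total s 1 with hs1 | hs1
  · have hmono : g s ≤ g (max 1 z₀) := h.monotoneOn hs hmax (hs1.trans (le_max_left _ _))
    linarith [mul_nonneg hs hgs]
  · linarith [le_mul_of_one_le_left hgs hs1, h.nonneg _ hmax]

theorem exists_mul_le_coupling (hα : 1 < α) (hC : 0 < C) (z₀ : ℝ) {ε : ℝ} (hε : 0 < ε) :
    ∃ K : ℝ, 0 ≤ K ∧ ∀ g, CouplingAssumption α C z₀ g → ∀ s b : ℝ, 0 ≤ s → 0 ≤ b →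
      s * b ≤ ε * (s * g s) + K * (1 + b ^ α) := by
  obtain ⟨K, hK, hyoung⟩ :=
    exists_young_le (Real.HolderConjugate.conjExponent hα).symm (div_pos hε hC)
  set Z := |z₀| ^ (α / (α - 1))
  have hZ : 0 ≤ ε / C * Z := by positivity
  refine ⟨ε / C * Z + K, add_nonneg hZ hK, fun g hg s b hs hb => ?_⟩
  calc s * b ≤ ε / C * s ^ (α / (α - 1)) + K * b ^ α := hyoung s b hs hb
    _ ≤ ε / C * (C * (s * g s) + Z) + K * b ^ α := by
      gcongr
      exact hg.rpow_le hα hC hs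
    _ = ε * (s * g s) + (ε / C * Z + K * b ^ α) := by
      field_simp
      ring
    _ ≤ ε * (s * g s) + (ε / C * Z + K) * (1 + b ^ α) := by
      have hbα : 0 ≤ ε / C * Z * b ^ α := by positivity
      linarith

theorem exists_mul_rpow_le_coupling (hα : 1 < α) (hC : 0 < C) (z₀ : ℝ) {c r ε : ℝ} (hc : 0 ≤ c)
    (hr : 0 ≤ r) (hrβ : r ≤ β) (hε : 0 < ε) :
    ∃ K : ℝ, 0 ≤ K ∧ ∀ g, CouplingAssumption α C z₀ g → ∀ s t : ℝ, 0 ≤ s → 0 ≤ t →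
      s * (c * t ^ r) ≤ ε * (s * g s) + K * (1 + t ^ (α * β)) := by
  obtain ⟨K, hK, habs⟩ := exists_mul_le_coupling hα hC z₀ hε
  have hα0 : 0 < α := one_pos.trans hα
  refine ⟨K * (1 + c ^ α), by positivity, fun g hg s t hs ht => ?_⟩
  have hpow : (c * t ^ r) ^ α ≤ c ^ α * (1 + t ^ (α * β)) := by
    rw [Real.mul_rpow hc (by positivity), ← Real.rpow_mul ht, mul_comm r α]
    gcongr
    exact rpow_le_one_add_rpow ht (mul_nonneg hα0.le hr) (by gcongr)
  have htαβ : 0 ≤ t ^ (α * β) := by positivity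
  calc s * (c * t ^ r) ≤ ε * (s * g s) + K * (1 + (c * t ^ r) ^ α) :=
        habs g hg s _ hs (by positivity)
    _ ≤ ε * (s * g s) + K * ((1 + c ^ α) * (1 + t ^ (α * β))) := by
      gcongr
      linarith
    _ = ε * (s * g s) + K * (1 + c ^ α) * (1 + t ^ (α * β)) := by ring

theorem exists_mul_rpow_sub_one_mul_le (hα : 1 < α) (hβ : 1 < β) (hC : 0 < C) (z₀ : ℝ) {ε : ℝ}
    (hε : 0 < ε) :
    ∃ K : ℝ, 0 ≤ K ∧ ∀ g, CouplingAssumption α C z₀ g → ∀ s p t : ℝ, 0 ≤ s → 0 ≤ p → 0 ≤ t →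
      s * (C * (p ^ (β - 1) + 1)) * t ≤
        ε * (s * g s + s * p ^ β / C) + K * (1 + t ^ (α * β)) := by
  obtain ⟨K, hK, hyoung⟩ :=
    exists_young_le (Real.HolderConjugate.conjExponent hβ).symm (div_pos hε hC)
  have hβ0 : 0 ≤ β := zero_le_one.trans hβ.le
  obtain ⟨K₁, hK₁, hpow⟩ := exists_mul_rpow_le_coupling hα hC z₀
    (show 0 ≤ K * C ^ β by positivity) hβ0 le_rfl (half_pos hε)
  obtain ⟨K₂, hK₂, hlin⟩ := exists_mul_rpow_le_coupling hα hC z₀ hC.le zero_le_one hβ.le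
    (half_pos hε)
  refine ⟨K₁ + K₂, by positivity, fun g hg s p t hs hp ht => ?_⟩
  have hpt : p ^ (β - 1) * (C * t) ≤ ε / C * p ^ β + K * C ^ β * t ^ β := by
    have := hyoung (p ^ (β - 1)) (C * t) (by positivity) (by positivity)
    rwa [← Real.rpow_mul hp, Real.conjExponent, mul_div_cancel₀ _ (sub_pos.2 hβ).ne',
      Real.mul_rpow hC.le ht, ← mul_assoc K] at this
  calc s * (C * (p ^ (β - 1) + 1)) * t = s * (p ^ (β - 1) * (C * t)) + s * (C * t ^ (1 : ℝ)) := by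
        rw [Real.rpow_one]
        ring
    _ ≤ s * (ε / C * p ^ β + K * C ^ β * t ^ β) + s * (C * t ^ (1 : ℝ)) := by gcongr
    _ = ε * (s * p ^ β / C) + s * (K * C ^ β * t ^ β) + s * (C * t ^ (1 : ℝ)) := by ring
    _ ≤ ε * (s * p ^ β / C) + (ε / 2 * (s * g s) + K₁ * (1 + t ^ (α * β))) +
        (ε / 2 * (s * g s) + K₂ * (1 + t ^ (α * β))) := by
      gcongr
      exacts [hpow g hg s t hs ht, hlin g hg s t hs ht]
    _ = ε * (s * g s + s * p ^ β / C) + (K₁ + K₂) * (1 + t ^ (α * β)) := by ring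

theorem exists_norm_le_coupling (hβ : 1 < β) (hC : 0 < C) (α z₀ : ℝ) {B ε : ℝ} (hB : 0 ≤ B)
    (hε : 0 < ε) :
    ∃ K : ℝ, 0 ≤ K ∧ ∀ g, CouplingAssumption α C z₀ g → ∀ s p : ℝ, 0 ≤ s → 0 ≤ p →
      p ^ β / C - C ≤ g s → B * p ≤ ε * (s * g s) + K := by
  obtain ⟨K, hK, hyoung⟩ :=
    exists_young_le (Real.HolderConjugate.conjExponent hβ) (div_pos hε hC)
  set K₁ := C * (max 1 z₀ ^ (1 / (α - 1)) + 1)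
  refine ⟨ε * (K₁ + C) + K * B ^ β.conjExponent, by positivity, fun g hg s p hs hp hgrowth => ?_⟩
  calc B * p = p * B := mul_comm B p
    _ ≤ ε / C * p ^ β + K * B ^ β.conjExponent := hyoung p B hp hB
    _ = ε * (p ^ β / C) + K * B ^ β.conjExponent := by ring
    _ ≤ ε * (s * g s + K₁ + C) + K * B ^ β.conjExponent := by
      gcongr
      linarith [hg.le_mul_add hs]
    _ = _ := by ring

theorem mul_add_mul_le_inner {E : Type*} [NormedAddCommGroup E] [InnerProductSpace ℝ E]
    {γ e c A B : ℝ} {p a w b : E} (hs : 0 ≤ s) (ha : ‖a‖ ≤ A) (hb : ‖b‖ ≤ B)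
    (he : e - c ≤ -γ + inner ℝ a p) :
    s * γ + s * e ≤ inner ℝ (s • a - b) (p - w) + s * c + s * A * ‖w‖ + B * ‖p‖ + B * ‖w‖ := by
  have hap := mul_le_mul_of_nonneg_left he hs
  have haw : s * inner ℝ a w ≤ s * A * ‖w‖ := by
    rw [mul_assoc]
    exact mul_le_mul_of_nonneg_left ((real_inner_le_norm a w).trans (by gcongr)) hs
  have hbp : inner ℝ b p ≤ B * ‖p‖ := (real_inner_le_norm b p).trans (by gcongr)
  have hbw : -(B * ‖w‖) ≤ inner ℝ b w :=
    neg_le_of_abs_le ((abs_real_inner_le_norm b w).trans (by gcongr))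
  have hinner : inner ℝ (s • a - b) (p - w) =
      s * inner ℝ a p - s * inner ℝ a w - inner ℝ b p + inner ℝ b w := by
    rw [inner_sub_left, inner_sub_right, inner_sub_right, real_inner_smul_left,
      real_inner_smul_left]
    ring
  rw [hinner]
  linarith

theorem exists_energy_le_inner (E : Type*) [NormedAddCommGroup E] [InnerProductSpace ℝ E]
    (hα : 1 < α) (hβ : 1 < β) (hC : 0 < C) (z₀ : ℝ) {B : ℝ} (hB : 0 ≤ B) :
    ∃ K : ℝ, 0 ≤ K ∧ ∀ g, CouplingAssumption α C z₀ g → ∀ (s : ℝ) (p a w b : E), 0 ≤ s →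
      ‖p‖ ^ β / C - C ≤ g s → ‖a‖ ≤ C * (‖p‖ ^ (β - 1) + 1) →
      ‖p‖ ^ β / C - C ≤ -g s + inner ℝ a p → ‖b‖ ≤ B →
      s * g s + (s + 1) * ‖p‖ ^ β / C ≤
        4 * inner ℝ (s • a - b) (p - w) + K * (1 + ‖w‖ ^ (α * β)) := by
  obtain ⟨K₁, hK₁, hs_le⟩ := exists_mul_le_coupling hα hC z₀ (show (0 : ℝ) < 1 / 6 by norm_num)
  obtain ⟨K₂, hK₂, haw_le⟩ :=
    exists_mul_rpow_sub_one_mul_le hα hβ hC z₀ (show (0 : ℝ) < 1 / 6 by norm_num)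
  obtain ⟨K₃, hK₃, hbp_le⟩ :=
    exists_norm_le_coupling hβ hC α z₀ hB (show (0 : ℝ) < 1 / 6 by norm_num)
  set M := C * (max 1 z₀ ^ (1 / (α - 1)) + 1)
  set L := 4 * (K₁ * (1 + C ^ α) + K₃) + (M + C)
  have hL : 0 ≤ L := by positivity
  refine ⟨L + 4 * (K₂ + B), by positivity, fun g hg s p a w b hs hgrowth ha hlag hb => ?_⟩
  have hαβ : 1 ≤ α * β := (one_lt_mul_of_lt_of_le hα hβ.le).le
  have hw : B * ‖w‖ ≤ B * (1 + ‖w‖ ^ (α * β)) := by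
    gcongr
    simpa only [Real.rpow_one] using rpow_le_one_add_rpow (norm_nonneg w) zero_le_one hαβ
  have hLw : L ≤ L * (1 + ‖w‖ ^ (α * β)) :=
    le_mul_of_one_le_right hL (le_add_of_nonneg_right (by positivity))
  have hnonneg : 0 ≤ s * ‖p‖ ^ β / C := by positivity
  have hduality := mul_add_mul_le_inner (w := w) hs ha hb hlag
  rw [← mul_div_assoc] at hduality
  rw [add_one_mul, add_div]
  linarith [hs_le g hg s C hs hC.le, haw_le g hg s ‖p‖ ‖w‖ hs (norm_nonneg p) (norm_nonneg w),
    hbp_le g hg s ‖p‖ hs (norm_nonneg p) hgrowth, hg.le_mul_add hs]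

/-! ### The energy estimate -/

/-- A `C^2` Hamiltonian of order `β` in the sense of the energy estimate: `H` and its Lagrangian
`D_pH · p - H` grow at least like `|p|^β`, and `D_pH` at most like `|p|^(β - 1)`. -/
structure HamiltonianGrowth (Ω : Set (Space d)) (β C : ℝ) (H : Space d → Space d → ℝ) :
    Prop where
  contDiffOn : ContDiffOn ℝ 2 (fun q : Space d × Space d => H q.1 q.2) (closure Ω ×ˢ univ)
  lower : ∀ x ∈ Ω, ∀ p, ‖p‖ ^ β / C - C ≤ H x p
  bound_Dp : ∀ x ∈ Ω, ∀ p, ‖∇ (H x) p‖ ≤ C * (‖p‖ ^ (β - 1) + 1)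
  lagrangian_lower : ∀ x ∈ Ω, ∀ p, ‖p‖ ^ β / C - C ≤ - H x p + inner ℝ (∇ (H x) p) p

theorem HamiltonianAssumption.hamiltonianGrowth (h : HamiltonianAssumption Ω β C H) :
    HamiltonianGrowth Ω β C H :=
  ⟨h.contDiffOn, h.lower, h.bound_Dp, h.lagrangian_lower⟩

theorem IsClassicalSolution.integrableOn_energy (h : IsClassicalSolution Ω ΓD ΓN g H j ψ m u)
    (hΩ : IsOpen Ω) (hb : Bornology.IsBounded Ω) (hβ : 0 ≤ β) (hg : ContinuousOn g (Ici 0)) :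
    IntegrableOn (fun x => m x * g (m x) + (m x + 1) * ‖∇ u x‖ ^ β / C) Ω := by
  obtain ⟨P, hP, hPu, -⟩ := h.boundary
  have hm : MapsTo m (closure Ω) (Ici 0) := by
    simpa only [isClosed_Ici.closure_eq] using
      MapsTo.closure_of_continuousOn (show MapsTo m Ω (Ici 0) from h.nonneg_m) h.continuousOn_m
  have hcont : ContinuousOn (fun x => m x * g (m x) + (m x + 1) * ‖P x‖ ^ β / C) (closure Ω) :=
    (h.continuousOn_m.mul (hg.comp h.continuousOn_m hm)).add
      (((h.continuousOn_m.add continuousOn_const).mul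
        (hP.norm.rpow_const fun _ _ => Or.inr hβ)).div_const C)
  refine (integrableOn_of_continuousOn_closure hb hcont).congr_fun (fun x hx => ?_)
    hΩ.measurableSet
  simp only [hPu x hx]

theorem IsAdmissibleField.exists_integral_energy_le {G W : Space d → Space d}
    (hG : IsAdmissibleField Ω ΓD ΓN j G) (hΩ : IsOpen Ω) (hb : Bornology.IsBounded Ω)
    (hΓ : HasC1Boundary Ω) (hD : ∃ O, IsOpen O ∧ ΓD = O ∩ frontier Ω)
    (hN : ∃ O, IsOpen O ∧ ΓN = O ∩ frontier Ω) (hcover : frontier Ω ⊆ closure ΓD ∪ closure ΓN)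
    (hα : 1 < α) (hβ : 1 < β) (hC : 0 < C) (z₀ : ℝ) (hψ : ContinuousOn ψ (closure Ω))
    (hW : IsWeakGradient Ω ψ W) (hWp : MemLp W (ENNReal.ofReal (α * β)) (volume.restrict Ω)) :
    ∃ C₀ : ℝ, 0 < C₀ ∧ ∀ (g : ℝ → ℝ) (H : Space d → Space d → ℝ), CouplingAssumption α C z₀ g →
      HamiltonianGrowth Ω β C H → ∀ m u, IsClassicalSolution Ω ΓD ΓN g H j ψ m u →
        ∫ x in Ω, (m x * g (m x) + (m x + 1) * ‖∇ u x‖ ^ β / C) ≤ C₀ := by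
  have : IsFiniteMeasure (volume.restrict Ω) :=
    isFiniteMeasure_restrict.2 hb.measure_lt_top.ne
  have hαβ : 1 ≤ α * β := (one_lt_mul_of_lt_of_le hα hβ.le).le
  have hWi : IntegrableOn W Ω := hWp.integrable (by simpa using hαβ)
  have hWpow : IntegrableOn (fun x => ‖W x‖ ^ (α * β)) Ω := by
    have := hWp.integrable_norm_rpow'
    rwa [ENNReal.toReal_ofReal (zero_le_one.trans hαβ)] at this
  obtain ⟨B, hB⟩ := hb.isCompact_closure.exists_bound_of_continuousOn hG.continuousOn
  obtain ⟨K, hK, henergy⟩ := exists_energy_le_inner (Space d) hα hβ hC z₀ (le_max_right B 0)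
  set R := ∫ x in Ω, K * (1 + ‖W x‖ ^ (α * β))
  have hR : 0 ≤ R := integral_nonneg fun x => by positivity
  have hRi : IntegrableOn (fun x => K * (1 + ‖W x‖ ^ (α * β))) Ω :=
    ((integrable_const 1).add hWpow).const_mul K
  refine ⟨R + 1, add_pos_of_nonneg_of_pos hR one_pos, fun g H hg hH m u h => ?_⟩
  obtain ⟨F, hF, hFu, hcost, hcontact⟩ := h.exists_isAdmissibleField hΩ hH.contDiffOn
  have hu := isWeakGradient_gradient hΩ (h.contDiffOn_u.of_le one_le_two)
  have hui := h.integrableOn_gradient hΩ hb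
  have hinner := hF.integral_inner_sub_nonpos hG hΩ hb hΓ hD hN hcover h.continuousOn_u hu hui hψ
    hW hWi hcost hcontact
  have hFGi : IntegrableOn (fun x => inner ℝ (F x - G x) (∇ u x - W x)) Ω :=
    integrableOn_inner_of_continuousOn_closure hΩ hb (hF.continuousOn.sub hG.continuousOn)
      (hui.sub hWi)
  calc ∫ x in Ω, (m x * g (m x) + (m x + 1) * ‖∇ u x‖ ^ β / C)
      ≤ ∫ x in Ω, (4 * inner ℝ (F x - G x) (∇ u x - W x) + K * (1 + ‖W x‖ ^ (α * β))) := by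
        refine setIntegral_mono_on (h.integrableOn_energy hΩ hb (zero_le_one.trans hβ.le)
          hg.contDiffOn.continuousOn) ((hFGi.const_mul 4).add hRi) hΩ.measurableSet fun x hx => ?_
        have hHJ := h.hamiltonJacobi x hx
        rw [hFu x hx]
        exact henergy g hg _ _ _ _ _ (h.nonneg_m x hx) (hHJ ▸ hH.lower x hx _)
          (hH.bound_Dp x hx _) (hHJ ▸ hH.lagrangian_lower x hx _)
          ((hB x (subset_closure hx)).trans (le_max_left B 0))
    _ = 4 * (∫ x in Ω, inner ℝ (F x - G x) (∇ u x - W x)) + R := by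
        rw [integral_add (hFGi.const_mul 4) hRi, integral_const_mul]
    _ ≤ R + 1 := by linarith

end MFG

end

theorem mainTheorem6_general {d : ℕ} {Ω ΓD ΓN : Set (MFG.Space d)} (hΩ : IsOpen Ω)
    (hb : Bornology.IsBounded Ω) (hΓ : MFG.HasC1Boundary Ω)
    (hD : ∃ O, IsOpen O ∧ ΓD = O ∩ frontier Ω) (hN : ∃ O, IsOpen O ∧ ΓN = O ∩ frontier Ω)
    (hcover : frontier Ω ⊆ closure ΓD ∪ closure ΓN) {α β C : ℝ} (z₀ : ℝ) (hα : 1 < α) (hβ : 1 < β)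
    (hC : 0 < C) (j : MFG.Space d → ℝ) {ψ : MFG.Space d → ℝ} {W : MFG.Space d → MFG.Space d}
    (hψ : ContinuousOn ψ (closure Ω)) (hW : MFG.IsWeakGradient Ω ψ W)
    (hWp : MemLp W (ENNReal.ofReal (α * β)) (volume.restrict Ω)) :
    ∃ C₀ : ℝ, 0 < C₀ ∧
      ∀ (g : ℝ → ℝ) (H : MFG.Space d → MFG.Space d → ℝ),
        MFG.CouplingAssumption α C z₀ g → MFG.HamiltonianGrowth Ω β C H →
        ∀ m u : MFG.Space d → ℝ, MFG.IsClassicalSolution Ω ΓD ΓN g H j ψ m u →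
          IntegrableOn (fun x => m x * g (m x) + (m x + 1) * ‖∇ u x‖ ^ β / C) Ω ∧
          ∫ x in Ω, (m x * g (m x) + (m x + 1) * ‖∇ u x‖ ^ β / C) ≤ C₀ := by
  by_cases hG : ∃ G, MFG.IsAdmissibleField Ω ΓD ΓN j G
  · obtain ⟨G, hG⟩ := hG
    obtain ⟨C₀, hC₀, hbound⟩ :=
      hG.exists_integral_energy_le hΩ hb hΓ hD hN hcover hα hβ hC z₀ hψ hW hWp
    exact ⟨C₀, hC₀, fun g H hg hH m u h =>
      ⟨h.integrableOn_energy hΩ hb (zero_le_one.trans hβ.le) hg.contDiffOn.continuousOn,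
        hbound g H hg hH m u h⟩⟩
  · refine ⟨1, one_pos, fun g H _ hH m u h => (hG ?_).elim⟩
    obtain ⟨F, hF, -⟩ := h.exists_isAdmissibleField hΩ hH.contDiffOn
    exact ⟨F, hF⟩

theorem mainTheorem6 (d : ℕ) (hd : 0 < d) (Ω ΓD ΓN : Set (MFG.Space d))
    (hΩ : MFG.IsC1Domain Ω) (hΓ : MFG.IsBoundaryPartition Ω ΓD ΓN)
    (α β C z₀ : ℝ) (hα : 1 < α) (hβ : 1 < β) (hC : 0 < C)
    (j : MFG.Space d → ℝ)
    (hj : MemLp j (ENNReal.ofReal (β / (β - 1))) ((MFG.surfaceMeasure d).restrict ΓN))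
    (hj0 : ∀ᵐ x ∂(MFG.surfaceMeasure d).restrict ΓN, 0 ≤ j x)
    (ψ : MFG.Space d → ℝ) (hψc : ContinuousOn ψ (closure Ω)) (hψ : MFG.MemW1 Ω (α * β) ψ) :
    ∃ C₀ : ℝ, 0 < C₀ ∧
      ∀ (g : ℝ → ℝ) (H : MFG.Space d → MFG.Space d → ℝ),
        MFG.CouplingAssumption α C z₀ g → MFG.HamiltonianAssumption Ω β C H →
        ∀ m u : MFG.Space d → ℝ, MFG.IsClassicalSolution Ω ΓD ΓN g H j ψ m u →
          IntegrableOn (fun x => m x * g (m x) + (m x + 1) * ‖∇ u x‖ ^ β / C) Ω ∧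
          ∫ x in Ω, (m x * g (m x) + (m x + 1) * ‖∇ u x‖ ^ β / C) ≤ C₀ := by
  obtain ⟨-, W, hWp, hW⟩ := hψ
  obtain ⟨C₀, hC₀, hbound⟩ := mainTheorem6_general hΩ.isOpen hΩ.isBounded hΩ.exists_chart
    hΓ.relOpen_D hΓ.relOpen_N hΓ.cover.subset z₀ hα hβ hC j hψc hW hWp
  exact ⟨C₀, hC₀, fun g H hg hH => hbound g H hg hH.hamiltonianGrowth⟩
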